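/- Let $G$ be a stratified (Carnot) Lie group of rank $2$, step $s\ge 3$ and dimension $m$, with Lie algebra $\mathfrak g=\mathfrak g_1\oplus\dots\oplus\mathfrak g_s$, $\mathfrak g_{i+1}=[\mathfrak g_1,\mathfrak g_i]$, $\dim\mathfrak g_1=2$. Let $X_1,\dots,X_m$ be a basis of left-invariant vector fields, each homogeneous of some degree $d(i)$ (that is, $X_i\in\mathfrak g_{d(i)}$), with $d(1)\le\dots\le d(m)$ (for example a Hall--Grayson--Grossman basis), and identify $G$ with $\mathbb R^m$ through the exponential coordinates of the second type $x\mapsto \exp(x_mX_m)\cdots\exp(x_1X_1)$. Write $\mathcal D(x)=\mathrm{span}\{X_1(x),X_2(x)\}$. For $\alpha\in\mathbb N^m$ let $[X_i,X_\alpha]$ be the left-nested commutator of $X_i$ with $\alpha_1$ times $X_1$, then $\alpha_2$ times $X_2$, …, then $\alpha_m$ times $X_m$, write $[X_i,X_\alpha]=\sum_k c_{i\alpha}^kX_k$, and for $v\in\mathbb R^m$ put $$P_i^v(x)=\sum_{\alpha}\frac{(-1)^{|\alpha|}}{\alpha!}\Big(\sum_{k=1}^m c_{i\alpha}^k v_k\Big)x^\alpha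 .$$ Let $\gamma:[0,1]\to\mathbb R^m$ be a Lipschitz horizontal curve with controls $h\in L^\infty([0,1];\mathbb R^2)$, i.e. $\dot\gamma=h_1X_1(\gamma)+h_2X_2(\gamma)$ a.e., and suppose that $\gamma$ is a Goh extremal: there is a Lipschitz curve $\xi:[0,1]\to\mathbb R^m$, nowhere zero, that solves the adjoint equations $\dot\xi_k=-\sum_{j=1}^2\sum_{i=1}^m\frac{\partial X_{ji}}{\partial x_k}(\gamma)h_j\xi_i$ a.e. and satisfies $\langle\xi,X_i(\gamma)\rangle=\langle\xi,[X_i,X_j](\gamma)\rangle=0$ on $[0,1]$ for $i,j\in\{1,2\}$. Let $\lambda_i=\langle\xi,X_i(\gamma)\rangle$, $i=1,\dots,m$, be the components of this dual curve, and let $\lambda^{(3)}=(\lambda_i)_{d(i)=3}$. Assume that $\lambda^{(3)}(t)\ne0$ for all $t\in[0,1]$. Then: (1) There is $v\in\mathbb R^m$, $v\neq0$, such that for all $t\in[0,1]$: $P_3^v(\gamma(t))=0$; $\nabla P_3^v(\gamma(t))\ne0$, so that $\Sigma=\{P_3^v=0\}$ is an analytic hypersurface near $\gamma([0,1])$; and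 $\Sigma$ is transversal to the horizontal distribution along $\gamma$: $\dim\big(\ker dP_3^v(\gamma(t))\cap\mathcal D(\gamma(t))\big)=1$. (2) $\gamma$ is an analytic curve up to the choice of the parameter: there are an open interval $(a,b)$, a real analytic curve $c:(a,b)\to\mathbb R^m$ with $\dot c=u_1X_1(c)+u_2X_2(c)$, $u_1^2+u_2^2=1$, and a Lipschitz function $\tau:[0,1]\to(a,b)$ such that $\gamma=c\circ\tau$. (3) If, in addition, $|h|$ is a.e. constant (the parameter is proportional to arc length) and $\gamma$ is locally injective, then $\gamma$ itself is real analytic on $[0,1]$. -/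

import Mathlib

open scoped ContDiff

noncomputable section

namespace Carnot

/-! ### Lie group structures on `ℝᵐ` and left-invariant vector fields -/

/-- A Lie group structure on the manifold `ℝᵐ`, with identity element `0`. -/
structure LieGroupLaw (m : ℕ) where
  mul : (Fin m → ℝ) → (Fin m → ℝ) → (Fin m → ℝ)
  inv : (Fin m → ℝ) → (Fin m → ℝ)
  mul_assoc : ∀ x y z, mul (mul x y) z = mul x (mul y z)
  zero_mul : ∀ x, mul 0 x = x
  mul_zero : ∀ x, mul x 0 = x
  inv_mul : ∀ x, mul (inv x) x = 0
  contDiff_mul : ContDiff ℝ ∞ (fun p : (Fin m → ℝ) × (Fin m → ℝ) => mul p.1 p.2)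
  contDiff_inv : ContDiff ℝ ∞ inv

variable {m : ℕ}

/-- The `i`-th vector of the standard basis of `ℝᵐ`. -/
def stdVec (i : Fin m) : Fin m → ℝ := Pi.single i 1

/-- The left-invariant vector field whose value at the identity `0` is `u`: at the point `x` it is
the differential at `0` of the left translation `y ↦ x * y`, applied to `u`. -/
def LieGroupLaw.leftInv (G : LieGroupLaw m) (u x : Fin m → ℝ) : Fin m → ℝ :=
  fderiv ℝ (fun y => G.mul x y) 0 u

/-- The frame `X_1, …, X_m` of left-invariant vector fields with `X_i(0) = e_i`. -/
def LieGroupLaw.frame (G : LieGroupLaw m) (i : Fin m) : (Fin m → ℝ) → (Fin m → ℝ) :=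
  G.leftInv (stdVec i)

/-- The Lie bracket of the Lie algebra of `G`, which is identified with `T_0 G = ℝᵐ`: the value at
`0` of the commutator of the left-invariant vector fields that extend `u` and `w`. The coordinates
of `G.bracket e_i e_j` are the structure constants `c_{ij}^k` of the frame. -/
def LieGroupLaw.bracket (G : LieGroupLaw m) (u w : Fin m → ℝ) : Fin m → ℝ :=
  VectorField.lieBracket ℝ (G.leftInv u) (G.leftInv w) 0

/-- The standard coordinates of `ℝᵐ` are exponential coordinates of the second type with respect to
the frame `X_1, …, X_m`: `t ↦ t e_i` is a one-parameter subgroup, so that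
`exp (t X_i) = t e_i`, and
`x = exp (x_m X_m) * ⋯ * exp (x_2 X_2) * exp (x_1 X_1)` for every `x`. -/
structure LieGroupLaw.IsSecondType (G : LieGroupLaw m) : Prop where
  exp_add : ∀ (i : Fin m) (a b : ℝ),
    G.mul (Pi.single i a) (Pi.single i b) = Pi.single i (a + b)
  factor : ∀ x : Fin m → ℝ,
    (List.finRange m).foldr (fun i y => G.mul y (Pi.single i (x i))) 0 = x

/-! ### Stratifications -/

/-- The layer `𝔤_i` of the Lie algebra: the span of the basis vectors of degree `i`. -/
def layer (d : Fin m → ℕ) (i : ℕ) : Submodule ℝ (Fin m → ℝ) :=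
  Submodule.span ℝ {u | ∃ k, d k = i ∧ u = stdVec k}

/-- `X_1, …, X_m` is a basis, ordered by the degrees `d`, which is adapted to a stratification
`𝔤 = 𝔤_1 ⊕ ⋯ ⊕ 𝔤_s` of step `s`, that is `𝔤_{i+1} = [𝔤_1, 𝔤_i]` for `i ≥ 1`, `𝔤_s ≠ 0` and
`𝔤_i = 0` for `i > s`. (The sum is direct because the layers are spanned by disjoint parts of a
basis.) -/
structure LieGroupLaw.IsStratified (G : LieGroupLaw m) (d : Fin m → ℕ) (s : ℕ) : Prop where
  mono : Monotone d
  one_le : ∀ k, 1 ≤ d k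
  le_step : ∀ k, d k ≤ s
  step_attained : ∃ k, d k = s
  layer_succ : ∀ i, 1 ≤ i →
    layer d (i + 1) = Submodule.span ℝ
      {z | ∃ u ∈ layer d 1, ∃ w ∈ layer d i, z = G.bracket u w}

/-- The indices of the horizontal vector fields, i.e. those of degree one. -/
abbrev HorIdx (d : Fin m → ℕ) : Type := {j : Fin m // d j = 1}

/-- The horizontal vector fields `X_1, …, X_r`. -/
def LieGroupLaw.hor (G : LieGroupLaw m) (d : Fin m → ℕ) (j : HorIdx d) :
    (Fin m → ℝ) → (Fin m → ℝ) :=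
  G.frame j.1

/-- The horizontal distribution `𝒟(x) = span {X_1(x), …, X_r(x)}`. -/
def LieGroupLaw.distribution (G : LieGroupLaw m) (d : Fin m → ℕ) (x : Fin m → ℝ) :
    Submodule ℝ (Fin m → ℝ) :=
  Submodule.span ℝ (Set.range fun j : HorIdx d => G.hor d j x)

/-! ### Extremal polynomials -/

/-- The iterated commutator `[X_i, X_α] = [X_i, X_1, …, X_1, X_2, …, X_2, …, X_m, …, X_m]`, where
`X_k` occurs `α k` times and brackets are nested to the left. -/
def LieGroupLaw.iterBracket (G : LieGroupLaw m) (i : Fin m) (α : Fin m → ℕ) : Fin m → ℝ :=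
  (List.finRange m).foldl
    (fun w k => (fun z => G.bracket z (stdVec k))^[α k] w) (stdVec i)

/-- The extremal polynomial
`P_i^v(x) = ∑_α ((-1)^|α| / α!) (∑_k c_{iα}^k v_k) x^α`, where `[X_i, X_α] = ∑_k c_{iα}^k X_k`.
In a stratified group of step `s` all terms with `|α| ≥ s` vanish, so that it is enough to sum
over the multi-indices with entries at most `s`. -/
def LieGroupLaw.extremalPoly (G : LieGroupLaw m) (s : ℕ) (i : Fin m) (v x : Fin m → ℝ) : ℝ :=
  ∑ α ∈ Fintype.piFinset (fun _ : Fin m => Finset.range (s + 1)),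
    (-1 : ℝ) ^ (∑ k, α k) / (∏ k, ((α k).factorial : ℝ)) *
      (∑ k, G.iterBracket i α k * v k) * ∏ k, x k ^ α k

/-! ### Horizontal curves and Goh extremals for a family of vector fields on `ℝᵐ` -/

/-- `γ : [0,1] → ℝᵐ` is a horizontal curve with controls `h ∈ L^∞`: it is Lipschitz and
`γ' = ∑_j h_j X_j(γ)` almost everywhere on `[0,1]`. -/
structure IsHorizontalCurve {J : Type} [Fintype J] (X : J → (Fin m → ℝ) → (Fin m → ℝ))
    (γ : ℝ → Fin m → ℝ) (h : ℝ → J → ℝ) : Prop where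
  lipschitz : ∃ K, LipschitzOnWith K γ (Set.Icc 0 1)
  memLp : MeasureTheory.MemLp h ⊤ (MeasureTheory.volume.restrict (Set.Icc (0 : ℝ) 1))
  hasDerivAt : ∀ᵐ t ∂MeasureTheory.volume.restrict (Set.Icc (0 : ℝ) 1),
    HasDerivAt γ (∑ j, h t j • X j (γ t)) t

/-- The adjoint equations `ξ_k' = - ∑_j ∑_i (∂X_{ji}/∂x_k)(γ) h_j ξ_i`, a.e. on `[0,1]`. -/
def SolvesAdjoint {J : Type} [Fintype J] (X : J → (Fin m → ℝ) → (Fin m → ℝ))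
    (γ : ℝ → Fin m → ℝ) (h : ℝ → J → ℝ) (ξ : ℝ → Fin m → ℝ) : Prop :=
  ∀ᵐ t ∂MeasureTheory.volume.restrict (Set.Icc (0 : ℝ) 1),
    HasDerivAt ξ
      (fun k => -∑ j, ∑ i, fderiv ℝ (X j) (γ t) (stdVec k) i * h t j * ξ t i) t

/-- `γ` is a Goh extremal with controls `h`, and `ξ` is a dual curve of `γ` that satisfies the
Goh condition. -/
structure IsGohExtremalWith {J : Type} [Fintype J] (X : J → (Fin m → ℝ) → (Fin m → ℝ))
    (γ : ℝ → Fin m → ℝ) (h : ℝ → J → ℝ) (ξ : ℝ → Fin m → ℝ) : Prop where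
  horizontal : IsHorizontalCurve X γ h
  lipschitz : ∃ K, LipschitzOnWith K ξ (Set.Icc 0 1)
  ne_zero : ∀ t ∈ Set.Icc (0 : ℝ) 1, ξ t ≠ 0
  adjoint : SolvesAdjoint X γ h ξ
  abnormal : ∀ t ∈ Set.Icc (0 : ℝ) 1, ∀ i, ξ t ⬝ᵥ X i (γ t) = 0
  goh : ∀ t ∈ Set.Icc (0 : ℝ) 1, ∀ i j,
    ξ t ⬝ᵥ VectorField.lieBracket ℝ (X i) (X j) (γ t) = 0

/-- The components `λ_i` of the dual curve `ξ` in the coframe `θ_1, …, θ_m` dual to the frame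
`X_1, …, X_m`: the relation `ξ = ∑_i λ_i θ_i(γ)` means `λ_i = ⟨ξ, X_i(γ)⟩`. -/
def LieGroupLaw.dualComponent (G : LieGroupLaw m) (γ ξ : ℝ → Fin m → ℝ) (i : Fin m) (t : ℝ) : ℝ :=
  ξ t ⬝ᵥ G.frame i (γ t)

end Carnot

end

noncomputable section

namespace Carnot

variable {m : ℕ}

/-! Along a horizontal curve, a solution of the adjoint equations keeps constant pairing with every
right-invariant field. Hence there is a fixed covector `v` with `⟨ξ, X_u(γ)⟩ = v ⬝ᵥ Ad(γ) u` for
every `u` in the Lie algebra (`exists_dual_eq_coadjoint`). In coordinates of the second type `Ad x`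
is the ordered product of the `exp (x_k ad X_k)`, whose expansion shows `P_i^v(x) = v ⬝ᵥ Ad(x) e_i`
(`extremalPoly_eq`). So the components of the dual curve are the extremal polynomials evaluated
along `γ`.

In rank two and step at least three, `𝔤_2` is the line of `X_3` (`rank_two`), and the Goh condition
says that `P_3^v` vanishes on `γ`. Its derivative along a horizontal `X_j` is `v ⬝ᵥ Ad(x) [X_j,
X_3]`. Since these brackets span `𝔤_3`, the hypothesis on `λ^{(3)}` makes the horizontal gradient
nonzero along `γ` (`dual_bracket_ne_zero`), which gives regularity and transversality.

Differentiating `P_3^v(γ) = 0` shows that `h` is orthogonal to this gradient, so `γ' = κ Y(γ)` with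
`Y` the rotated unit gradient field. `Y` is analytic near `γ` because second-type coordinates make
the left-invariant frame analytic. With `τ` a primitive of `κ` and `c` the integral curve of `Y`,
Gronwall uniqueness gives `γ = c ∘ τ` (`exists_analytic_reparametrization`), and `c` is analytic by
`analyticAt_of_hasDerivAt`. Finally `κ² = |h|²`: if this is constant and `γ` is locally injective,
then `τ` is locally monotone with constant speed, hence affine. -/

theorem minSmoothness_two_le_infty : minSmoothness ℝ 2 ≤ (∞ : WithTop ℕ∞) := by
  rw [minSmoothness_of_isRCLikeNormedField]
  exact WithTop.coe_le_coe.2 le_top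

namespace LieGroupLaw

/-! ### Left translations and the adjoint representation -/

/-- The differential at the identity of the left translation by `x`. -/
def leftDiff (G : LieGroupLaw m) (x : Fin m → ℝ) : (Fin m → ℝ) →L[ℝ] (Fin m → ℝ) :=
  fderiv ℝ (G.mul x) 0

/-- The adjoint representation of the group. -/
def Ad (G : LieGroupLaw m) (x : Fin m → ℝ) : (Fin m → ℝ) →L[ℝ] (Fin m → ℝ) :=
  fderiv ℝ (fun y => G.mul (G.mul x y) (G.inv x)) 0

variable (G : LieGroupLaw m)

theorem leftInv_eq (u x : Fin m → ℝ) : G.leftInv u x = G.leftDiff x u := rfl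

theorem mul_inv (x : Fin m → ℝ) : G.mul x (G.inv x) = 0 := by
  have h1 := G.inv_mul (G.inv x)
  calc G.mul x (G.inv x) = G.mul 0 (G.mul x (G.inv x)) := (G.zero_mul _).symm
    _ = G.mul (G.mul (G.inv (G.inv x)) (G.inv x)) (G.mul x (G.inv x)) := by rw [h1]
    _ = G.mul (G.inv (G.inv x)) (G.mul (G.mul (G.inv x) x) (G.inv x)) := by
        simp only [G.mul_assoc]
    _ = 0 := by rw [G.inv_mul, G.zero_mul, h1]

theorem inv_eq_of_mul {x y : Fin m → ℝ} (h : G.mul x y = 0) : G.inv x = y := by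
  calc G.inv x = G.mul (G.inv x) (G.mul x y) := by rw [h, G.mul_zero]
    _ = y := by rw [← G.mul_assoc, G.inv_mul, G.zero_mul]

theorem inv_inv (x : Fin m → ℝ) : G.inv (G.inv x) = x := G.inv_eq_of_mul (G.inv_mul x)

theorem inv_zero : G.inv 0 = 0 := G.inv_eq_of_mul (G.zero_mul 0)

theorem mul_inv_rev (x y : Fin m → ℝ) : G.inv (G.mul x y) = G.mul (G.inv y) (G.inv x) := by
  apply G.inv_eq_of_mul
  rw [G.mul_assoc, ← G.mul_assoc y, G.mul_inv, G.zero_mul, G.mul_inv]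

theorem contDiff_mul_left (x : Fin m → ℝ) : ContDiff ℝ ∞ (G.mul x) :=
  G.contDiff_mul.comp (contDiff_const.prodMk contDiff_id)

theorem contDiff_mul_right (x : Fin m → ℝ) : ContDiff ℝ ∞ (fun y => G.mul y x) :=
  G.contDiff_mul.comp (contDiff_id.prodMk contDiff_const)

theorem differentiable_mul_left (x : Fin m → ℝ) : Differentiable ℝ (G.mul x) :=
  (G.contDiff_mul_left x).differentiable (by simp)

theorem differentiable_mul_right (x : Fin m → ℝ) : Differentiable ℝ (fun y => G.mul y x) :=
  (G.contDiff_mul_right x).differentiable (by simp)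

theorem leftDiff_zero : G.leftDiff 0 = ContinuousLinearMap.id ℝ _ := by
  have : G.mul 0 = id := funext G.zero_mul
  rw [leftDiff, this, fderiv_id]

theorem contDiff_leftDiff : ContDiff ℝ ∞ G.leftDiff :=
  ContDiff.fderiv (n := ∞) (m := ∞) (f := fun x y => G.mul x y) (g := fun _ => 0) G.contDiff_mul
    contDiff_const (by simp)

theorem differentiable_leftDiff : Differentiable ℝ G.leftDiff :=
  G.contDiff_leftDiff.differentiable (by simp)

theorem contDiff_conj : ContDiff ℝ ∞
    (fun p : (Fin m → ℝ) × (Fin m → ℝ) => G.mul (G.mul p.1 p.2) (G.inv p.1)) :=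
  G.contDiff_mul.comp (G.contDiff_mul.prodMk (G.contDiff_inv.comp contDiff_fst))

theorem differentiable_conj (x : Fin m → ℝ) :
    Differentiable ℝ (fun y => G.mul (G.mul x y) (G.inv x)) :=
  (G.differentiable_mul_right _).comp (G.differentiable_mul_left x)

theorem contDiff_Ad : ContDiff ℝ ∞ G.Ad :=
  ContDiff.fderiv (n := ∞) (m := ∞) (f := fun x y => G.mul (G.mul x y) (G.inv x))
    (g := fun _ => 0) G.contDiff_conj contDiff_const (by simp)

theorem differentiable_Ad : Differentiable ℝ G.Ad :=
  G.contDiff_Ad.differentiable (by simp)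

theorem Ad_zero : G.Ad 0 = ContinuousLinearMap.id ℝ _ := by
  have : (fun y => G.mul (G.mul 0 y) (G.inv 0)) = id := by
    funext y; simp [G.zero_mul, G.inv_zero, G.mul_zero]
  rw [Ad, this, fderiv_id]

theorem Ad_mul (x y : Fin m → ℝ) : G.Ad (G.mul x y) = (G.Ad x).comp (G.Ad y) := by
  have h : (fun z => G.mul (G.mul (G.mul x y) z) (G.inv (G.mul x y))) =
      (fun z => G.mul (G.mul x z) (G.inv x)) ∘ fun z => G.mul (G.mul y z) (G.inv y) := by
    funext z
    simp only [Function.comp, G.mul_inv_rev, G.mul_assoc]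
  have h0 : G.mul (G.mul y 0) (G.inv y) = 0 := by rw [G.mul_zero, G.mul_inv]
  rw [Ad, h, fderiv_comp _ (by rw [h0]; exact G.differentiable_conj x _)
    (G.differentiable_conj y _), h0]
  rfl

theorem Ad_inv_comp (x : Fin m → ℝ) :
    (G.Ad (G.inv x)).comp (G.Ad x) = ContinuousLinearMap.id ℝ _ := by
  rw [← Ad_mul, G.inv_mul, Ad_zero]

theorem Ad_comp_inv (x : Fin m → ℝ) :
    (G.Ad x).comp (G.Ad (G.inv x)) = ContinuousLinearMap.id ℝ _ := by
  rw [← Ad_mul, G.mul_inv, Ad_zero]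

theorem leftDiff_mul (x y : Fin m → ℝ) :
    G.leftDiff (G.mul x y) = (fderiv ℝ (G.mul x) y).comp (G.leftDiff y) := by
  have h : G.mul (G.mul x y) = G.mul x ∘ G.mul y := by
    funext z; simp [G.mul_assoc]
  rw [leftDiff, h, fderiv_comp _ (G.differentiable_mul_left x _) (G.differentiable_mul_left y _),
    G.mul_zero]
  rfl

/-- Differentiate `(x z) y = (x y)(y⁻¹ z y)` in `z` at the identity. -/
theorem fderiv_mul_right_comp_leftDiff (x y : Fin m → ℝ) :
    (fderiv ℝ (fun z => G.mul z y) x).comp (G.leftDiff x) =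
      (G.leftDiff (G.mul x y)).comp (G.Ad (G.inv y)) := by
  have h : (fun z => G.mul z y) ∘ G.mul x =
      G.mul (G.mul x y) ∘ fun z => G.mul (G.mul (G.inv y) z) (G.inv (G.inv y)) := by
    funext z
    simp only [Function.comp, G.inv_inv, G.mul_assoc]
    rw [← G.mul_assoc y, G.mul_inv, G.zero_mul]
  have h0 : G.mul (G.mul (G.inv y) 0) (G.inv (G.inv y)) = 0 := by rw [G.mul_zero, G.mul_inv]
  have h1 := congrArg (fun f => fderiv ℝ f 0) h
  rw [fderiv_comp _ (G.differentiable_mul_right y _) (G.differentiable_mul_left x _),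
    fderiv_comp _ (G.differentiable_mul_left _ _) (G.differentiable_conj _ _), h0, G.mul_zero] at h1
  exact h1

/-- The left-trivialized derivative of a product of two maps into the group. -/
theorem hasFDerivAt_mul {F : Type*} [NormedAddCommGroup F] [NormedSpace ℝ F]
    {f g : F → Fin m → ℝ} {f' g' : F →L[ℝ] (Fin m → ℝ)} {p : F}
    (hf : HasFDerivAt f ((G.leftDiff (f p)).comp f') p)
    (hg : HasFDerivAt g ((G.leftDiff (g p)).comp g') p) :
    HasFDerivAt (fun q => G.mul (f q) (g q))
      ((G.leftDiff (G.mul (f p) (g p))).comp ((G.Ad (G.inv (g p))).comp f' + g')) p := by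
  have hμ := (G.contDiff_mul.differentiable (by simp) (f p, g p)).hasFDerivAt
  have h := hμ.comp p (hf.prodMk hg)
  refine h.congr_fderiv ?_
  set D := fderiv ℝ (fun p : (Fin m → ℝ) × (Fin m → ℝ) => G.mul p.1 p.2) (f p, g p)
  have h1 : fderiv ℝ (fun z => G.mul z (g p)) (f p) =
      D.comp (ContinuousLinearMap.inl ℝ _ _) :=
    (HasFDerivAt.comp (g := fun p : (Fin m → ℝ) × (Fin m → ℝ) => G.mul p.1 p.2)
      (f := fun e => (e, g p)) (f p) hμ (hasFDerivAt_prodMk_left (f p) (g p))).fderiv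
  have h2 : fderiv ℝ (G.mul (f p)) (g p) = D.comp (ContinuousLinearMap.inr ℝ _ _) :=
    (HasFDerivAt.comp (g := fun p : (Fin m → ℝ) × (Fin m → ℝ) => G.mul p.1 p.2)
      (f := fun e => (f p, e)) (g p) hμ (hasFDerivAt_prodMk_right (f p) (g p))).fderiv
  rw [ContinuousLinearMap.comp_add, ← ContinuousLinearMap.comp_assoc,
    ← fderiv_mul_right_comp_leftDiff, leftDiff_mul, h1, h2]
  ext1 w
  simp only [ContinuousLinearMap.comp_apply, add_apply,
    ContinuousLinearMap.prod_apply, ContinuousLinearMap.inl_apply, ContinuousLinearMap.inr_apply,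
    ← map_add, Prod.mk_add_mk, add_zero, zero_add]

/-! ### The bracket -/

theorem fderiv_leftInv (u x y : Fin m → ℝ) :
    fderiv ℝ (G.leftInv u) x y = fderiv ℝ G.leftDiff x y u := by
  have h := (G.differentiable_leftDiff x).hasFDerivAt.clm_apply (hasFDerivAt_const u x)
  have h2 : fderiv ℝ (G.leftInv u) x = _ := h.fderiv
  rw [h2]
  simp

theorem contDiff_leftInv (u : Fin m → ℝ) : ContDiff ℝ ∞ (G.leftInv u) :=
  G.contDiff_leftDiff.clm_apply contDiff_const

theorem bracket_eq (u w : Fin m → ℝ) :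
    G.bracket u w = fderiv ℝ G.leftDiff 0 u w - fderiv ℝ G.leftDiff 0 w u := by
  simp [bracket, VectorField.lieBracket, fderiv_leftInv, leftInv_eq, leftDiff_zero]

/-- The adjoint representation of the Lie algebra, as a bilinear map. -/
def ad : (Fin m → ℝ) →L[ℝ] (Fin m → ℝ) →L[ℝ] (Fin m → ℝ) :=
  fderiv ℝ G.leftDiff 0 - (fderiv ℝ G.leftDiff 0).flip

theorem ad_apply (u w : Fin m → ℝ) : G.ad u w = G.bracket u w := by
  simp [ad, bracket_eq]

theorem bracket_swap (u w : Fin m → ℝ) : G.bracket u w = -G.bracket w u := by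
  simp [bracket_eq]

/-- Differentiating the chain rule for `G.mul x ∘ G.mul y` in `y` at `0` produces the second
derivative of the translation, which is symmetric and cancels in the commutator, plus the translated
bracket at the identity. -/
theorem lieBracket_leftInv (u w x : Fin m → ℝ) :
    VectorField.lieBracket ℝ (G.leftInv u) (G.leftInv w) x = G.leftInv (G.bracket u w) x := by
  have key : ∀ a b, fderiv ℝ G.leftDiff x (G.leftDiff x a) b =
      fderiv ℝ (fderiv ℝ (G.mul x)) 0 a b + G.leftDiff x (fderiv ℝ G.leftDiff 0 a b) := by
    intro a b
    have h1 : HasFDerivAt (fun y => G.leftDiff (G.mul x y))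
        ((fderiv ℝ G.leftDiff x).comp (G.leftDiff x)) 0 := by
      have hd : HasFDerivAt G.leftDiff (fderiv ℝ G.leftDiff x) (G.mul x 0) := by
        rw [G.mul_zero]; exact (G.differentiable_leftDiff x).hasFDerivAt
      exact hd.comp 0 (G.differentiable_mul_left x 0).hasFDerivAt
    have h2 : HasFDerivAt (fun y => (fderiv ℝ (G.mul x) y).comp (G.leftDiff y)) _ 0 :=
      (((G.contDiff_mul_left x).fderiv_right (m := ∞) (by simp)).differentiable
        (by simp) 0).hasFDerivAt.clm_comp (G.differentiable_leftDiff 0).hasFDerivAt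
    have h3 := h1.unique (h2.congr_of_eventuallyEq
      (Filter.Eventually.of_forall fun y => G.leftDiff_mul x y))
    have h4 := congrArg (fun L => L a b) h3
    simp [leftDiff_zero] at h4
    rw [h4, add_comm]
    rfl
  have hs : IsSymmSndFDerivAt ℝ (G.mul x) 0 :=
    ((G.contDiff_mul_left x).contDiffAt).isSymmSndFDerivAt minSmoothness_two_le_infty
  simp only [VectorField.lieBracket, fderiv_leftInv, leftInv_eq, key, bracket_eq, map_sub, hs u w]
  abel

/-- Left translation is conjugation followed by right translation, so `leftDiff x = N x ∘ Ad x`. At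
`0` the derivatives of `leftDiff` and `N` are the mixed second derivatives of the product in the two
orders, and their difference is the bracket. -/
theorem fderiv_Ad_zero_apply (u w : Fin m → ℝ) : fderiv ℝ G.Ad 0 u w = G.bracket u w := by
  set μ : (Fin m → ℝ) × (Fin m → ℝ) → Fin m → ℝ := fun p => G.mul p.1 p.2 with hμ
  have hμd : Differentiable ℝ μ := G.contDiff_mul.differentiable (by simp)
  have hμ2 : HasFDerivAt (fderiv ℝ μ) (fderiv ℝ (fderiv ℝ μ) 0) 0 :=
    ((G.contDiff_mul.fderiv_right (m := ∞) (by simp)).differentiable (by simp) 0).hasFDerivAt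
  have hs : IsSymmSndFDerivAt ℝ μ 0 :=
    (G.contDiff_mul.contDiffAt).isSymmSndFDerivAt minSmoothness_two_le_infty
  set N : (Fin m → ℝ) → (Fin m → ℝ) →L[ℝ] (Fin m → ℝ) :=
    fun x => fderiv ℝ (fun y => G.mul y x) 0 with hN
  have hL : ∀ x, G.leftDiff x = (fderiv ℝ μ (x, 0)).comp (ContinuousLinearMap.inr ℝ _ _) :=
    fun x => (HasFDerivAt.comp (g := μ) (f := fun e => (x, e))
      (0 : Fin m → ℝ) (hμd (x, 0)).hasFDerivAt
      (hasFDerivAt_prodMk_right x 0)).fderiv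
  have hR : ∀ x, N x = (fderiv ℝ μ (0, x)).comp (ContinuousLinearMap.inl ℝ _ _) :=
    fun x => (HasFDerivAt.comp (g := μ) (f := fun e => (e, x))
      (0 : Fin m → ℝ) (hμd (0, x)).hasFDerivAt
      (hasFDerivAt_prodMk_left 0 x)).fderiv
  have hL' : HasFDerivAt G.leftDiff _ 0 :=
    ((HasFDerivAt.comp (g := fderiv ℝ μ) (f := fun e => (e, 0)) (0 : Fin m → ℝ) hμ2
      (hasFDerivAt_prodMk_left 0 0)).clm_comp
      (hasFDerivAt_const (ContinuousLinearMap.inr ℝ _ _) _)).congr_of_eventuallyEq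
      (Filter.Eventually.of_forall hL)
  have hR' : HasFDerivAt N _ 0 :=
    ((HasFDerivAt.comp (g := fderiv ℝ μ) (f := fun e => (0, e)) (0 : Fin m → ℝ) hμ2
      (hasFDerivAt_prodMk_right 0 0)).clm_comp
      (hasFDerivAt_const (ContinuousLinearMap.inl ℝ _ _) _)).congr_of_eventuallyEq
      (Filter.Eventually.of_forall hR)
  have hfac : ∀ x, G.leftDiff x = (N x).comp (G.Ad x) := by
    intro x
    have h : G.mul x = (fun y => G.mul y x) ∘ fun y => G.mul (G.mul x y) (G.inv x) := by
      funext y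
      simp only [Function.comp]
      rw [G.mul_assoc _ _ x, G.inv_mul, G.mul_zero]
    have h0 : G.mul (G.mul x 0) (G.inv x) = 0 := by rw [G.mul_zero, G.mul_inv]
    rw [leftDiff, h, fderiv_comp _ (by rw [h0]; exact G.differentiable_mul_right x _)
      (G.differentiable_conj x _), h0]
    rfl
  have hN0 : N 0 = ContinuousLinearMap.id ℝ _ := by
    have := hfac 0
    rw [leftDiff_zero, Ad_zero, ContinuousLinearMap.comp_id] at this
    exact this.symm
  have hfac' := hL'.unique ((hR'.clm_comp (G.differentiable_Ad 0).hasFDerivAt).congr_of_eventuallyEq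
      (Filter.Eventually.of_forall hfac))
  have e1 := hL'.fderiv
  have h4 := congrArg (fun L => L u w) hfac'
  have h5 := hs (u, 0) (0, w)
  simp [hN0, Ad_zero] at h4
  rw [bracket_eq, e1]
  simp
  have h6 := hs (0, u) (w, 0)
  rw [h4, h6]
  abel

/-- Homomorphism property `Ad (x y) = Ad x ∘ Ad y`, differentiated in `y` at the identity. -/
theorem fderiv_Ad_leftDiff (x u w : Fin m → ℝ) :
    fderiv ℝ G.Ad x (G.leftDiff x u) w = G.Ad x (G.bracket u w) := by
  have h1 : HasFDerivAt (fun y => G.Ad (G.mul x y))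
      ((fderiv ℝ G.Ad x).comp (G.leftDiff x)) 0 := by
    have hd : HasFDerivAt G.Ad (fderiv ℝ G.Ad x) (G.mul x 0) := by
      rw [G.mul_zero]; exact (G.differentiable_Ad x).hasFDerivAt
    exact hd.comp 0 (G.differentiable_mul_left x 0).hasFDerivAt
  have h2 := ((hasFDerivAt_const (G.Ad x) 0).clm_comp (G.differentiable_Ad 0).hasFDerivAt)
  have h3 := h1.unique (h2.congr_of_eventuallyEq
    (Filter.Eventually.of_forall fun y => G.Ad_mul x y))
  have h4 := congrArg (fun L => L u w) h3
  simpa [fderiv_Ad_zero_apply] using h4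

theorem jacobi (u v w : Fin m → ℝ) :
    G.bracket u (G.bracket v w) = G.bracket (G.bracket u v) w + G.bracket v (G.bracket u w) := by
  have h := VectorField.leibniz_identity_lieBracket (𝕜 := ℝ) (n := ∞) (x := 0)
    minSmoothness_two_le_infty
    (G.contDiff_leftInv u).contDiffAt (G.contDiff_leftInv v).contDiffAt
    (G.contDiff_leftInv w).contDiffAt
  have e : ∀ a b, VectorField.lieBracket ℝ (G.leftInv a) (G.leftInv b) =
      G.leftInv (G.bracket a b) := fun a b => funext (G.lieBracket_leftInv a b)
  simp only [e] at h
  simpa [leftInv_eq, leftDiff_zero] using h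

/-! ### Nilpotency -/

section Nilpotent

variable {G : LieGroupLaw m} {d : Fin m → ℕ} {s : ℕ}

theorem stdVec_mem_layer (d : Fin m → ℕ) (k : Fin m) : stdVec k ∈ layer d (d k) :=
  Submodule.subset_span ⟨k, rfl, rfl⟩

theorem IsStratified.layer_eq_bot (hd : G.IsStratified d s) {i : ℕ} (hi : s < i) :
    layer d i = ⊥ := by
  rw [layer, Submodule.span_eq_bot]
  rintro u ⟨k, rfl, -⟩
  exact absurd (hd.le_step k) (not_le.2 hi)

/-- The stratification only controls brackets with `𝔤_1`. Writing an element of `𝔤_{i+1}` through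
brackets `[a, b]` with `a ∈ 𝔤_1`, the Jacobi identity reduces to `𝔤_i` and to brackets with `𝔤_1`.
-/
theorem IsStratified.bracket_mem_layer (hd : G.IsStratified d s) {i : ℕ} (hi : 1 ≤ i) :
    ∀ {j : ℕ}, 1 ≤ j → ∀ {u w : Fin m → ℝ}, u ∈ layer d i → w ∈ layer d j →
      G.bracket u w ∈ layer d (i + j) := by
  have base : ∀ {j : ℕ}, 1 ≤ j → ∀ {u w : Fin m → ℝ}, u ∈ layer d 1 → w ∈ layer d j →
      G.bracket u w ∈ layer d (j + 1) := by
    intro j hj u w hu hw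
    rw [hd.layer_succ j hj]
    exact Submodule.subset_span ⟨u, hu, w, hw, rfl⟩
  induction i, hi using Nat.le_induction with
  | base => intro j hj u w hu hw; rw [add_comm]; exact base hj hu hw
  | succ i hi ih =>
    intro j hj u w hu hw
    rw [hd.layer_succ i hi] at hu
    induction hu using Submodule.span_induction with
    | mem z hz =>
      obtain ⟨a, ha, b, hb, rfl⟩ := hz
      have h := G.jacobi a b w
      rw [eq_sub_of_add_eq h.symm]
      have h1 := base (by omega) ha (ih hj hb hw)
      have h2 := ih (by omega) hb (base hj ha hw)
      rw [show i + 1 + j = i + j + 1 by omega]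
      exact Submodule.sub_mem _ h1 h2
    | zero => rw [← ad_apply, map_zero]; exact Submodule.zero_mem _
    | add x y _ _ hx hy =>
      rw [← ad_apply, map_add]
      simp only [add_apply, ad_apply]
      exact Submodule.add_mem _ hx hy
    | smul a x _ hx =>
      rw [← ad_apply, map_smul]
      simp only [smul_apply, ad_apply]
      exact Submodule.smul_mem _ _ hx

theorem IsStratified.ad_pow_eq_zero (hd : G.IsStratified d s) (k : Fin m) {n : ℕ} (hn : s < n) :
    G.ad (stdVec k) ^ n = 0 := by
  have key : ∀ l n, (G.ad (stdVec k) ^ n) (stdVec l) ∈ layer d (n * d k + d l) := by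
    intro l n
    induction n with
    | zero => simpa using stdVec_mem_layer d l
    | succ n ih =>
      rw [pow_succ', mul_apply_eq_comp, ad_apply,
        show (n + 1) * d k + d l = d k + (n * d k + d l) by ring]
      exact hd.bracket_mem_layer (hd.one_le k) ((hd.one_le l).trans (Nat.le_add_left _ _))
        (stdVec_mem_layer d k) ih
  apply ContinuousLinearMap.coe_injective
  apply (Pi.basisFun ℝ (Fin m)).ext
  intro l
  have h := key l n
  rw [hd.layer_eq_bot (by nlinarith [hd.one_le k]), Submodule.mem_bot] at h
  rw [Pi.basisFun_apply]
  exact h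

end Nilpotent

/-! ### Exponential coordinates of the second type -/

section SecondType

variable {G : LieGroupLaw m}

theorem IsSecondType.inv_single (hG : G.IsSecondType) (k : Fin m) (t : ℝ) :
    G.inv (Pi.single k t) = Pi.single k (-t) := by
  apply G.inv_eq_of_mul
  rw [hG.exp_add]
  simp

/-- The coordinate line `a ↦ a e_k` is a one-parameter subgroup, hence an integral curve of its
left-invariant field. -/
theorem IsSecondType.leftDiff_single (hG : G.IsSecondType) (k : Fin m) (t : ℝ) :
    G.leftDiff (Pi.single k t) (stdVec k) = stdVec k := by
  have hlin : ∀ r, HasDerivAt (fun a : ℝ => (Pi.single k a : Fin m → ℝ)) (stdVec k) r := by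
    intro r
    simpa [stdVec] using
      ((ContinuousLinearMap.single ℝ (fun _ : Fin m => ℝ) k).hasDerivAt (x := r))
  have h1 : HasDerivAt (fun a : ℝ => G.mul (Pi.single k t) (Pi.single k a))
      (G.leftDiff (Pi.single k t) (stdVec k)) 0 := by
    have hd : HasFDerivAt (G.mul (Pi.single k t)) (G.leftDiff (Pi.single k t))
        (Pi.single k (0 : ℝ)) := by
      rw [Pi.single_zero]; exact (G.differentiable_mul_left _ 0).hasFDerivAt
    exact hd.comp_hasDerivAt 0 (hlin 0)
  have h2 : HasDerivAt (fun a : ℝ => G.mul (Pi.single k t) (Pi.single k a)) (stdVec k) 0 := by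
    simp only [hG.exp_add]
    have := (hlin (t + 0)).comp_const_add t 0
    exact this
  exact h1.unique h2

theorem IsSecondType.hasFDerivAt_single (hG : G.IsSecondType) (k : Fin m) (x : Fin m → ℝ) :
    HasFDerivAt (fun y : Fin m → ℝ => (Pi.single k (y k) : Fin m → ℝ))
      ((G.leftDiff (Pi.single k (x k))).comp
        ((ContinuousLinearMap.proj (R := ℝ) (φ := fun _ : Fin m => ℝ) k).smulRight
          (stdVec k))) x := by
  have h : HasFDerivAt (fun y : Fin m → ℝ => (Pi.single k (y k) : Fin m → ℝ))
    ((ContinuousLinearMap.single ℝ (fun _ : Fin m => ℝ) k).comp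
      (ContinuousLinearMap.proj (R := ℝ) (φ := fun _ : Fin m => ℝ) k)) x :=
    ((ContinuousLinearMap.single ℝ (fun _ : Fin m => ℝ) k).comp
      (ContinuousLinearMap.proj (R := ℝ) (φ := fun _ : Fin m => ℝ) k)).hasFDerivAt
  refine h.congr_fderiv ?_
  ext1 w
  simp only [ContinuousLinearMap.comp_apply, ContinuousLinearMap.smulRight_apply, map_smul,
    hG.leftDiff_single]
  ext j
  by_cases hj : j = k <;> simp [stdVec, hj]

/-- Uniqueness for the linear differential equation `φ' = φ A` in a Banach algebra. -/
theorem eq_exp_of_hasDerivAt {R : Type*} [NormedRing R] [NormedAlgebra ℝ R] [CompleteSpace R]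
    {φ : ℝ → R} {A : R} (hφ : ∀ t, HasDerivAt φ (φ t * A) t) (h0 : φ 0 = 1) (t : ℝ) :
    φ t = NormedSpace.exp (t • A) := by
  let _ : NormedAlgebra ℚ R := NormedAlgebra.restrictScalars ℚ ℝ R
  have hexp : ∀ t : ℝ, HasDerivAt (fun r : ℝ => NormedSpace.exp (r • (-A)))
      (-A * NormedSpace.exp (t • (-A))) t := fun t => hasDerivAt_exp_smul_const' (-A) t
  have hconst : ∀ t : ℝ, HasDerivAt (fun r : ℝ => φ r * NormedSpace.exp (r • (-A))) 0 t := by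
    intro t
    refine ((hφ t).mul (hexp t)).congr_deriv ?_
    rw [← _root_.mul_assoc, ← add_mul]
    simp
  have h1 := is_const_of_deriv_eq_zero (fun t => (hconst t).differentiableAt)
    (fun t => (hconst t).deriv) t 0
  simp only [h0, zero_smul, NormedSpace.exp_zero, mul_one] at h1
  have hc : Commute (t • (-A)) (t • A) := by
    rw [smul_neg]; exact (Commute.refl (t • A)).neg_left
  have h2 : NormedSpace.exp (t • (-A)) * NormedSpace.exp (t • A) = 1 := by
    rw [← NormedSpace.exp_add_of_commute hc, smul_neg, neg_add_cancel, NormedSpace.exp_zero]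
  rw [← one_mul (NormedSpace.exp (t • A)), ← h1, _root_.mul_assoc, h2, mul_one]

theorem IsSecondType.Ad_single (hG : G.IsSecondType) (k : Fin m) (t : ℝ) :
    G.Ad (Pi.single k t) = NormedSpace.exp (t • G.ad (stdVec k)) := by
  set A := G.ad (stdVec k)
  have hφ : ∀ t : ℝ, HasDerivAt (fun r : ℝ => G.Ad (Pi.single k r))
      (G.Ad (Pi.single k t) * A) t := by
    intro t
    have hlin : HasDerivAt (fun a : ℝ => (Pi.single k a : Fin m → ℝ)) (stdVec k) t := by
      simpa [stdVec] using
        ((ContinuousLinearMap.single ℝ (fun _ : Fin m => ℝ) k).hasDerivAt (x := t))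
    have h := (G.differentiable_Ad (Pi.single k t)).hasFDerivAt.comp_hasDerivAt t hlin
    refine h.congr_deriv ?_
    ext1 w
    have h2 := G.fderiv_Ad_leftDiff (Pi.single k t) (stdVec k) w
    rw [hG.leftDiff_single] at h2
    rw [h2, mul_apply_eq_comp, ad_apply]
  exact eq_exp_of_hasDerivAt hφ (by rw [Pi.single_zero, Ad_zero]; rfl) t

/-- The product `exp (x_{i_n} X_{i_n}) ⋯ exp (x_{i_1} X_{i_1})` over a list `i_1, …, i_n`. -/
def expProd (G : LieGroupLaw m) (l : List (Fin m)) (x : Fin m → ℝ) : Fin m → ℝ :=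
  l.foldr (fun i y => G.mul y (Pi.single i (x i))) 0

/-- The left-trivialized differential of `expProd`. -/
def expProdLog (G : LieGroupLaw m) :
    List (Fin m) → (Fin m → ℝ) → (Fin m → ℝ) →L[ℝ] (Fin m → ℝ)
  | [], _ => 0
  | i :: l, x => (G.Ad (G.inv (Pi.single i (x i)))).comp (expProdLog G l x) +
      (ContinuousLinearMap.proj (R := ℝ) (φ := fun _ : Fin m => ℝ) i).smulRight (stdVec i)

theorem IsSecondType.hasFDerivAt_expProd (hG : G.IsSecondType) (l : List (Fin m))
    (x : Fin m → ℝ) :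
    HasFDerivAt (G.expProd l) ((G.leftDiff (G.expProd l x)).comp (G.expProdLog l x)) x := by
  induction l with
  | nil =>
    simp only [expProdLog, ContinuousLinearMap.comp_zero]
    exact hasFDerivAt_const _ _
  | cons i l ih => exact G.hasFDerivAt_mul ih (hG.hasFDerivAt_single i x)

theorem analyticAt_exp_smul (A : (Fin m → ℝ) →L[ℝ] (Fin m → ℝ)) (c : ℝ) (i : Fin m)
    (x : Fin m → ℝ) :
    AnalyticAt ℝ (fun y : Fin m → ℝ => NormedSpace.exp ((c * y i) • A)) x := by
  have h1 : AnalyticAt ℝ (fun y : Fin m → ℝ => (c * y i) • A) x :=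
    (analyticAt_const.mul
      ((ContinuousLinearMap.proj (R := ℝ) (φ := fun _ : Fin m => ℝ) i).analyticAt x)).smul
      analyticAt_const
  exact AnalyticAt.comp (f := fun y : Fin m → ℝ => (c * y i) • A)
    (NormedSpace.exp_analytic (𝕂 := ℝ) ((c * x i) • A)) h1

/-- The group law is only assumed smooth. Analyticity enters here, because the factors are operator
exponentials of linear functions of the coordinates. -/
theorem IsSecondType.analyticAt_expProdLog (hG : G.IsSecondType) (l : List (Fin m))
    (x : Fin m → ℝ) : AnalyticAt ℝ (G.expProdLog l) x := by
  induction l with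
  | nil => exact analyticAt_const
  | cons i l ih =>
    have h1 : AnalyticAt ℝ (fun y : Fin m → ℝ => G.Ad (G.inv (Pi.single i (y i)))) x := by
      simp only [hG.inv_single, hG.Ad_single]
      simpa using analyticAt_exp_smul (G.ad (stdVec i)) (-1) i x
    exact (h1.mul ih).add analyticAt_const

/-- Over the full list of indices `expProd` is the identity map, so `leftDiff` is the inverse of the
analytic operator `expProdLog`, and inversion is analytic on units. -/
theorem IsSecondType.analyticAt_leftDiff (hG : G.IsSecondType) (x : Fin m → ℝ) :
    AnalyticAt ℝ G.leftDiff x := by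
  have h1 : ∀ y, G.leftDiff y * G.expProdLog (List.finRange m) y = 1 := by
    intro y
    have h := hG.hasFDerivAt_expProd (List.finRange m) y
    have hid : G.expProd (List.finRange m) = id := funext hG.factor
    rw [hid] at h
    exact h.unique (hasFDerivAt_id y)
  have h2 : ∀ y, G.expProdLog (List.finRange m) y * G.leftDiff y = 1 := by
    intro y
    have h := G.leftDiff_mul (G.inv y) y
    rw [G.inv_mul, leftDiff_zero] at h
    have h' : fderiv ℝ (G.mul (G.inv y)) y * G.leftDiff y = 1 := h.symm
    rw [← left_inv_eq_right_inv h' (h1 y), h']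
  set U : (y : Fin m → ℝ) → ((Fin m → ℝ) →L[ℝ] (Fin m → ℝ))ˣ :=
    fun y => ⟨G.expProdLog (List.finRange m) y, G.leftDiff y, h2 y, h1 y⟩
  have h3 : G.leftDiff = fun y => Ring.inverse (G.expProdLog (List.finRange m) y) := by
    funext y
    exact (Ring.inverse_unit (U y)).symm
  rw [h3]
  exact AnalyticAt.comp (f := G.expProdLog (List.finRange m))
    (analyticAt_inverse (𝕜 := ℝ) (U x)) (hG.analyticAt_expProdLog _ x)

/-- The head of the list is the rightmost group factor, so its exponential acts first. This order
matches the left nesting in `iterBracket`. -/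
theorem IsSecondType.Ad_expProd (hG : G.IsSecondType) (l : List (Fin m)) (x u : Fin m → ℝ) :
    G.Ad (G.expProd l x) u =
      l.foldl (fun w k => NormedSpace.exp (x k • G.ad (stdVec k)) w) u := by
  induction l generalizing u with
  | nil => simp [expProd, Ad_zero]
  | cons i l ih =>
    change G.Ad (G.mul (G.expProd l x) (Pi.single i (x i))) u = _
    rw [Ad_mul, List.foldl_cons, ← ih, hG.Ad_single]
    rfl

theorem IsSecondType.analyticAt_Ad (hG : G.IsSecondType) (x : Fin m → ℝ) :
    AnalyticAt ℝ G.Ad x := by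
  have key : ∀ l, AnalyticAt ℝ (fun y => G.Ad (G.expProd l y)) x := by
    intro l
    induction l with
    | nil => exact analyticAt_const (v := G.Ad 0)
    | cons i l ih =>
      have h1 : AnalyticAt ℝ (fun y : Fin m → ℝ => G.Ad (Pi.single i (y i))) x := by
        simp only [hG.Ad_single]
        simpa using analyticAt_exp_smul (G.ad (stdVec i)) 1 i x
      have h2 : (fun y => G.Ad (G.expProd (i :: l) y)) =
          fun y => G.Ad (G.expProd l y) * G.Ad (Pi.single i (y i)) :=
        funext fun y => G.Ad_mul _ _
      rw [h2]
      exact AnalyticAt.mul ih h1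
  have h := key (List.finRange m)
  have hid : ∀ y, G.expProd (List.finRange m) y = y := hG.factor
  simpa only [hid] using h

end SecondType

/-! ### The extremal polynomials and the coadjoint action -/

theorem foldl_iterate_eq_linear {V ι : Type*} [AddCommGroup V] [Module ℝ V] (B : ι → V →ₗ[ℝ] V)
    (α : ι → ℕ) (l : List ι) :
    ∃ L : V →ₗ[ℝ] V, ∀ u, l.foldl (fun w k => (B k)^[α k] w) u = L u := by
  induction l with
  | nil => exact ⟨LinearMap.id, fun u => rfl⟩
  | cons i l ih =>
    obtain ⟨L, hL⟩ := ih
    refine ⟨L ∘ₗ (B i ^ α i), fun u => ?_⟩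
    rw [List.foldl_cons, hL, LinearMap.comp_apply, Module.End.pow_apply]

/-- Expansion of a composition of polynomials in non-commuting operators. -/
theorem foldl_sum_iterate {V : Type*} [AddCommGroup V] [Module ℝ V] (N : ℕ) {n : ℕ}
    (B : Fin n → V →ₗ[ℝ] V) (c : Fin n → ℕ → ℝ) (u : V) :
    (List.finRange n).foldl (fun w k => ∑ a ∈ Finset.range N, c k a • (B k)^[a] w) u =
      ∑ α ∈ Fintype.piFinset (fun _ : Fin n => Finset.range N),
        (∏ k, c k (α k)) • (List.finRange n).foldl (fun w k => (B k)^[α k] w) u := by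
  induction n generalizing u with
  | zero => simp
  | succ n ih =>
    simp only [List.finRange_succ, List.foldl_cons, List.foldl_map]
    rw [ih (fun k => B k.succ) (fun k => c k.succ)]
    have hlin : ∀ α : Fin n → ℕ, (List.finRange n).foldl (fun w k => (B k.succ)^[α k] w)
        (∑ a ∈ Finset.range N, c 0 a • (B 0)^[a] u) =
        ∑ a ∈ Finset.range N, c 0 a •
          (List.finRange n).foldl (fun w k => (B k.succ)^[α k] w) ((B 0)^[a] u) := by
      intro α
      obtain ⟨L, hL⟩ := foldl_iterate_eq_linear (fun k : Fin n => B k.succ) α (List.finRange n)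
      simp only [hL, map_sum, map_smul]
    simp only [hlin, Finset.smul_sum, smul_smul]
    rw [← Finset.sum_product']
    refine Finset.sum_bij' (fun p _ => Fin.cons p.2 p.1) (fun α _ => (Fin.tail α, α 0))
      ?_ ?_ ?_ ?_ ?_
    · intro p hp
      rw [Finset.mem_product] at hp
      rw [Fintype.mem_piFinset]
      intro k
      refine Fin.cases ?_ (fun k => ?_) k
      · simpa using hp.2
      · simpa using (Fintype.mem_piFinset.1 hp.1) k
    · intro α hα
      rw [Fintype.mem_piFinset] at hα
      rw [Finset.mem_product, Fintype.mem_piFinset]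
      exact ⟨fun k => hα k.succ, hα 0⟩
    · intro p _; simp
    · intro α _; simp
    · intro p _
      simp [Fin.prod_univ_succ, mul_comm]

/-- Nilpotency truncates the exponential series. Passing from `[X_k, ·]` to `[·, X_k]` creates the
signs of the extremal polynomial. -/
theorem IsStratified.exp_smul_ad {G : LieGroupLaw m} {d : Fin m → ℕ} {s : ℕ}
    (hd : G.IsStratified d s) (k : Fin m) (t : ℝ) (w : Fin m → ℝ) :
    NormedSpace.exp (t • G.ad (stdVec k)) w = ∑ a ∈ Finset.range (s + 1),
      ((-1) ^ a / (a.factorial : ℝ) * t ^ a) • (G.ad.flip (stdVec k)).toLinearMap^[a] w := by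
  have hflip : ∀ (a : ℕ) (z : Fin m → ℝ), (G.ad (stdVec k) ^ a) z =
      (-1 : ℝ) ^ a • (G.ad.flip (stdVec k)).toLinearMap^[a] z := by
    intro a
    induction a with
    | zero => intro z; simp
    | succ a ih =>
      intro z
      rw [pow_succ, mul_apply_eq_comp, ih, Function.iterate_succ_apply, ad_apply,
        G.bracket_swap, ← Module.End.pow_apply, ← Module.End.pow_apply]
      simp [ad_apply, pow_succ]
  rw [NormedSpace.exp_eq_tsum ℝ]
  simp only
  rw [tsum_eq_sum (s := Finset.range (s + 1))]
  · simp only [sum_apply, smul_pow, smul_apply, hflip, smul_smul]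
    refine Finset.sum_congr rfl fun a _ => ?_
    congr 1
    ring
  · intro n hn
    rw [smul_pow, hd.ad_pow_eq_zero k (by simpa using hn)]
    simp

/-- Expanding the product of truncated exponentials over multi-indices gives the coefficients
`(-1)^|α| x^α / α!` in front of `[X_i, X_α]`. -/
theorem IsStratified.extremalPoly_eq {G : LieGroupLaw m} {d : Fin m → ℕ} {s : ℕ}
    (hG : G.IsSecondType) (hd : G.IsStratified d s) (i : Fin m) (v x : Fin m → ℝ) :
    G.extremalPoly s i v x = v ⬝ᵥ G.Ad x (stdVec i) := by
  have h1 : G.Ad x (stdVec i) = (List.finRange m).foldl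
      (fun w k => NormedSpace.exp (x k • G.ad (stdVec k)) w) (stdVec i) := by
    rw [← hG.Ad_expProd]
    exact congrArg (fun y => G.Ad y (stdVec i)) (hG.factor x).symm
  rw [h1]
  simp only [hd.exp_smul_ad]
  rw [foldl_sum_iterate (s + 1) (fun k => (G.ad.flip (stdVec k)).toLinearMap), dotProduct_sum,
    extremalPoly]
  refine Finset.sum_congr rfl fun α _ => ?_
  have h2 : (List.finRange m).foldl
      (fun w k => (G.ad.flip (stdVec k)).toLinearMap^[α k] w) (stdVec i) = G.iterBracket i α := by
    have : ∀ k, (⇑(G.ad.flip (stdVec k)).toLinearMap : (Fin m → ℝ) → Fin m → ℝ) =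
        fun z => G.bracket z (stdVec k) := by
      intro k; funext z; exact G.ad_apply z _
    simp only [this]
    rfl
  rw [h2, dotProduct_smul, Finset.prod_mul_distrib, Finset.prod_div_distrib,
    Finset.prod_pow_eq_pow_sum, smul_eq_mul, dotProduct]
  simp only [mul_comm (v _)]
  ring

end LieGroupLaw

/-! ### Solutions of analytic differential equations are analytic -/

section AnalyticODE

open scoped Topology ENNReal NNReal

variable {E F : Type*} [NormedAddCommGroup E] [NormedSpace ℝ E] [NormedAddCommGroup F]
  [NormedSpace ℝ F] {K : Type*} [TopologicalSpace K] [CompactSpace K]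

/-- The pointwise action of a continuous multilinear map on continuous functions. -/
def multilinearOnFunctions {n : ℕ} (p : E [×n]→L[ℝ] F) : C(K, E) [×n]→L[ℝ] C(K, F) :=
  MultilinearMap.mkContinuous
    { toFun := fun z => ⟨fun s => p fun i => z i s, by fun_prop⟩
      map_update_add' := by
        intro _ z i x y
        ext s
        have h : ∀ x : C(K, E), (fun j => (Function.update z i x j) s) =
            Function.update (fun j => z j s) i (x s) := by
          intro x; funext j; by_cases hj : j = i
          · subst hj; simp
          · simp [hj]
        simp [h]
      map_update_smul' := by
        intro _ z i c x
        ext s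
        have h : ∀ x : C(K, E), (fun j => (Function.update z i x j) s) =
            Function.update (fun j => z j s) i (x s) := by
          intro x; funext j; by_cases hj : j = i
          · subst hj; simp
          · simp [hj]
        simp [h] }
    ‖p‖ (by
      intro z
      rw [ContinuousMap.norm_le _ (by positivity)]
      intro s
      refine (p.le_opNorm _).trans ?_
      gcongr with i
      exact (z i).norm_coe_le_norm s)

theorem norm_multilinearOnFunctions_le {n : ℕ} (p : E [×n]→L[ℝ] F) :
    ‖(multilinearOnFunctions p : C(K, E) [×n]→L[ℝ] C(K, F))‖ ≤ ‖p‖ :=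
  MultilinearMap.mkContinuous_norm_le _ (norm_nonneg _) _

/-- Superposition with an analytic function is an analytic operation on continuous functions. -/
theorem exists_analyticAt_superposition [CompleteSpace F] {f : E → F} {x₀ : E}
    (hf : AnalyticAt ℝ f x₀) :
    ∃ N : C(K, E) → C(K, F), AnalyticAt ℝ N 0 ∧ ∃ r > 0, ∀ z : C(K, E), ‖z‖ < r →
      ∀ s, N z s = f (x₀ + z s) := by
  obtain ⟨p, R, hp⟩ := hf
  set P : FormalMultilinearSeries ℝ C(K, E) C(K, F) := fun n => multilinearOnFunctions (p n) with hP
  have hrad : R ≤ P.radius :=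
    hp.r_le.trans (FormalMultilinearSeries.radius_le_of_le fun n =>
      norm_multilinearOnFunctions_le (p n))
  have hPs := P.hasFPowerSeriesOnBall (hp.r_pos.trans_le hrad)
  obtain ⟨r, hr0, hr⟩ := ENNReal.lt_iff_exists_nnreal_btwn.1 hp.r_pos
  refine ⟨P.sum, hPs.analyticAt, r, by exact_mod_cast hr0, fun z hz s => ?_⟩
  have hzR : z ∈ Metric.eball (0 : C(K, E)) R := by
    rw [mem_eball_zero_iff]
    refine lt_trans ?_ hr
    rw [enorm_eq_nnnorm]
    exact_mod_cast hz
  have hzs : z s ∈ Metric.eball (0 : E) R := by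
    rw [mem_eball_zero_iff]
    rw [mem_eball_zero_iff] at hzR
    refine lt_of_le_of_lt ?_ hzR
    rw [enorm_eq_nnnorm, enorm_eq_nnnorm]
    exact_mod_cast z.norm_coe_le_norm s
  have h1 := P.hasSum (Metric.eball_subset_eball hrad hzR)
  have h2 := h1.mapL (ContinuousMap.evalCLM ℝ s)
  have h3 := hp.hasSum hzs
  exact h2.unique h3

/-- The primitive `s ↦ ∫_0^s g` of a continuous function on `[0,1]`. -/
def primitiveCLM (E : Type*) [NormedAddCommGroup E] [NormedSpace ℝ E] :
    C(Set.Icc (0 : ℝ) 1, E) →L[ℝ] C(Set.Icc (0 : ℝ) 1, E) :=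
  LinearMap.mkContinuous
    { toFun := fun g => ⟨fun s => ∫ σ in (0 : ℝ)..s, Set.IccExtend zero_le_one g σ,
        (intervalIntegral.continuous_primitive
          (fun a b => (g.continuous.Icc_extend').intervalIntegrable a b) 0).comp
          continuous_subtype_val⟩
      map_add' := by
        intro g h
        ext s
        simp only [ContinuousMap.coe_mk, ContinuousMap.add_apply]
        rw [← intervalIntegral.integral_add
          ((g.continuous.Icc_extend').intervalIntegrable _ _)
          ((h.continuous.Icc_extend').intervalIntegrable _ _)]
        rfl
      map_smul' := by
        intro c g
        ext s
        simp only [ContinuousMap.coe_mk, ContinuousMap.smul_apply, RingHom.id_apply]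
        rw [← intervalIntegral.integral_smul]
        rfl }
    1 (by
      intro g
      rw [one_mul, ContinuousMap.norm_le _ (norm_nonneg _)]
      intro s
      have h := intervalIntegral.norm_integral_le_of_norm_le_const (a := (0 : ℝ)) (b := s)
        (f := Set.IccExtend zero_le_one g) (C := ‖g‖) (fun σ _ => g.norm_coe_le_norm _)
      refine h.trans ?_
      rw [sub_zero, abs_of_nonneg s.2.1]
      exact mul_le_of_le_one_right (norm_nonneg _) s.2.2)

theorem primitiveCLM_apply (g : C(Set.Icc (0 : ℝ) 1, E)) (s : Set.Icc (0 : ℝ) 1) :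
    primitiveCLM E g s = ∫ σ in (0 : ℝ)..s, Set.IccExtend zero_le_one g σ := rfl

/-- The shear `(t, z) ↦ (t, z - t w)`. -/
def shearEquiv {W : Type*} [NormedAddCommGroup W] [NormedSpace ℝ W] (w : W) :
    (ℝ × W) ≃L[ℝ] (ℝ × W) :=
  ContinuousLinearEquiv.equivOfInverse
    ((ContinuousLinearMap.fst ℝ ℝ W).prod
      (ContinuousLinearMap.snd ℝ ℝ W - (ContinuousLinearMap.fst ℝ ℝ W).smulRight w))
    ((ContinuousLinearMap.fst ℝ ℝ W).prod
      (ContinuousLinearMap.snd ℝ ℝ W + (ContinuousLinearMap.fst ℝ ℝ W).smulRight w))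
    (fun p => by simp) (fun p => by simp)

/-- The rescaled curves `z_t(s) = c(ts) - c(0)` solve `z_t = t ∫ Y(c(0) + z_t)` in `C([0,1], E)`.
The analytic inverse function theorem makes `t ↦ z_t` analytic at `0`, and `c(t) = c(0) + z_t(1)`.
-/
theorem analyticAt_zero_of_hasDerivAt [CompleteSpace E] {Y : E → E} {c : ℝ → E}
    (hY : AnalyticAt ℝ Y (c 0)) (hc : ∀ᶠ t in 𝓝 (0 : ℝ), HasDerivAt c (Y (c t)) t) :
    AnalyticAt ℝ c 0 := by
  obtain ⟨N, hN, r, hr, hNr⟩ :=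
    exists_analyticAt_superposition (K := Set.Icc (0 : ℝ) 1) hY
  have hYc : ∀ᶠ t in 𝓝 (0 : ℝ), ContinuousAt Y (c t) :=
    hc.self_of_nhds.continuousAt.eventually (hY.eventually_analyticAt.mono
      fun x hx => hx.continuousAt)
  obtain ⟨δ, hδ, hδc⟩ := Metric.eventually_nhds_iff.1 (hc.and hYc)
  set e := δ / 2 with he
  have he0 : 0 < e := by positivity
  have hcd : ∀ t ∈ Set.Icc (-e) e, HasDerivAt c (Y (c t)) t ∧ ContinuousAt Y (c t) := by
    intro t ht
    refine hδc ?_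
    rw [Real.dist_0_eq_abs]
    have := abs_le.2 ht
    linarith
  have hle : -e ≤ e := by linarith
  -- The solution is continuous only near `0`; freezing it outside `[-e, e]` makes `z` a globally
  -- defined continuous family.
  set ĉ : ℝ → E := Set.IccExtend hle ((Set.Icc (-e) e).domRestrict c) with hĉ
  have hĉc : Continuous ĉ := by
    refine Continuous.Icc_extend' (continuousOn_iff_continuous_domRestrict.1 fun t ht => ?_)
    exact (hcd t ht).1.continuousAt.continuousWithinAt
  have hĉe : ∀ t ∈ Set.Icc (-e) e, ĉ t = c t := fun t ht => by
    rw [hĉ, Set.IccExtend_of_mem hle _ ht]; rfl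
  set z : C(ℝ, C(Set.Icc (0 : ℝ) 1, E)) :=
    ContinuousMap.curry ⟨fun p : ℝ × Set.Icc (0 : ℝ) 1 => ĉ (p.1 * p.2) - c 0, by fun_prop⟩
    with hz
  have hz_apply : ∀ t s, z t s = ĉ (t * s) - c 0 := fun t s => rfl
  have hz0 : z 0 = 0 := by
    ext s
    rw [hz_apply, zero_mul, hĉe 0 ⟨by linarith, he0.le⟩, sub_self]
    rfl
  set Ψ : ℝ × C(Set.Icc (0 : ℝ) 1, E) → ℝ × C(Set.Icc (0 : ℝ) 1, E) :=
    fun q => (q.1, q.2 - q.1 • primitiveCLM E (N q.2)) with hΨ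
  have hA : AnalyticAt ℝ (fun q : ℝ × C(Set.Icc (0 : ℝ) 1, E) => primitiveCLM E (N q.2)) (0, 0) :=
    AnalyticAt.comp (g := primitiveCLM E) (f := fun q : ℝ × C(Set.Icc (0 : ℝ) 1, E) => N q.2)
      ((primitiveCLM E).analyticAt _)
      (AnalyticAt.comp_of_eq (g := N) (f := fun q : ℝ × C(Set.Icc (0 : ℝ) 1, E) => q.2) hN
        analyticAt_snd rfl)
  have hΨa : AnalyticAt ℝ Ψ (0, 0) :=
    analyticAt_fst.prod (analyticAt_snd.sub (analyticAt_fst.smul hA))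
  -- The derivative of `N` is multiplied by `t = 0`, so only a shear remains, and it is invertible.
  have hΨ' : HasFDerivAt Ψ
      (shearEquiv (primitiveCLM E (N 0)) : ℝ × C(Set.Icc (0 : ℝ) 1, E) →L[ℝ] ℝ × C(Set.Icc (0 : ℝ) 1, E)) (0, 0) := by
    have h := hasFDerivAt_fst (𝕜 := ℝ) (p := ((0 : ℝ), (0 : C(Set.Icc (0 : ℝ) 1, E)))) |>.prodMk
      (hasFDerivAt_snd (𝕜 := ℝ) (p := ((0 : ℝ), (0 : C(Set.Icc (0 : ℝ) 1, E)))) |>.sub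
        (hasFDerivAt_fst (𝕜 := ℝ) (p := ((0 : ℝ), (0 : C(Set.Icc (0 : ℝ) 1, E)))) |>.smul
          hA.differentiableAt.hasFDerivAt))
    refine h.congr_fderiv ?_
    ext <;> simp [shearEquiv]
  have hΨc : ContDiffAt ℝ ω Ψ (0, 0) := hΨa.contDiffAt
  have hΨ0 : Ψ (0, 0) = (0, 0) := by simp [hΨ]
  have hLa : AnalyticAt ℝ (hΨc.localInverse hΨ' (by simp)) (0, 0) := by
    have h := (hΨc.to_localInverse hΨ' (by simp)).analyticAt
    rwa [hΨ0] at h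
  have hleft : ∀ᶠ q in 𝓝 ((0 : ℝ), (0 : C(Set.Icc (0 : ℝ) 1, E))),
      hΨc.localInverse hΨ' (by simp) (Ψ q) = q :=
    (hΨc.hasStrictFDerivAt' hΨ' (by simp)).eventually_left_inverse
  have htz : Filter.Tendsto (fun t : ℝ => (t, z t)) (𝓝 0) (𝓝 (0, 0)) := by
    have h : Continuous fun t : ℝ => (t, z t) := continuous_id.prodMk z.continuous
    simpa [hz0] using h.tendsto 0
  have hsmall : ∀ᶠ t in 𝓝 (0 : ℝ), ‖z t‖ < r := by
    have h : Continuous fun t : ℝ => ‖z t‖ := z.continuous.norm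
    have := h.tendsto 0
    rw [hz0, norm_zero] at this
    exact this.eventually (gt_mem_nhds hr)
  have hint : ∀ᶠ t in 𝓝 (0 : ℝ), t ∈ Set.Icc (-e) e := Icc_mem_nhds (by linarith) he0
  have hmul : ∀ t ∈ Set.Icc (-e) e, ∀ s ∈ Set.Icc (0 : ℝ) 1, t * s ∈ Set.Icc (-e) e := by
    intro t ht s hs
    rw [Set.mem_Icc, ← abs_le] at ht
    rw [Set.mem_Icc, ← abs_le, abs_mul, abs_of_nonneg hs.1]
    exact (mul_le_of_le_one_right (abs_nonneg t) hs.2).trans ht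
  have hsol : ∀ᶠ t in 𝓝 (0 : ℝ), Ψ (t, z t) = (t, 0) := by
    filter_upwards [hsmall, hint] with t hts htI
    refine Prod.ext rfl ?_
    ext s
    simp only [hΨ, ContinuousMap.sub_apply, ContinuousMap.smul_apply, ContinuousMap.zero_apply,
      primitiveCLM_apply, hz_apply]
    rw [hĉe _ (hmul t htI s s.2), ← intervalIntegral.integral_smul]
    have hcongr : ∫ σ in (0 : ℝ)..s, t • Set.IccExtend zero_le_one (N (z t)) σ =
        ∫ σ in (0 : ℝ)..s, t • Y (c (t * σ)) := by
      refine intervalIntegral.integral_congr fun σ hσ => ?_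
      rw [Set.uIcc_of_le s.2.1] at hσ
      have hσ' : σ ∈ Set.Icc (0 : ℝ) 1 := ⟨hσ.1, hσ.2.trans s.2.2⟩
      rw [Set.IccExtend_of_mem _ _ hσ', hNr _ hts, hz_apply, hĉe _ (hmul t htI σ hσ')]
      simp
    have hderiv : ∀ σ ∈ Set.uIcc (0 : ℝ) s,
        HasDerivAt (fun σ => c (t * σ)) (t • Y (c (t * σ))) σ := by
      intro σ hσ
      rw [Set.uIcc_of_le s.2.1] at hσ
      have h := (hcd _ (hmul t htI σ ⟨hσ.1, hσ.2.trans s.2.2⟩)).1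
      exact h.scomp σ (by simpa using (hasDerivAt_id σ).const_mul t)
    have hcont : ContinuousOn (fun σ => t • Y (c (t * σ))) (Set.uIcc (0 : ℝ) s) := by
      intro σ hσ
      have h1 := (hderiv σ hσ).continuousAt
      rw [Set.uIcc_of_le s.2.1] at hσ
      have h2 := (hcd _ (hmul t htI σ ⟨hσ.1, hσ.2.trans s.2.2⟩)).2
      exact (continuousAt_const.smul
        (ContinuousAt.comp (f := fun σ => c (t * σ)) h2 h1)).continuousWithinAt
    rw [hcongr, intervalIntegral.integral_eq_sub_of_hasDerivAt hderiv hcont.intervalIntegrable]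
    simp
  have hfin : ∀ᶠ t in 𝓝 (0 : ℝ),
      c 0 + ((hΨc.localInverse hΨ' (by simp)) (t, 0)).2 ⟨1, by simp⟩ = c t := by
    filter_upwards [hsol, htz.eventually hleft, hint] with t h1 h2 h3
    rw [← h1, h2]
    simp only [hz_apply, mul_one]
    rw [hĉe t h3]
    simp
  have hta : AnalyticAt ℝ (fun t : ℝ => (t, (0 : C(Set.Icc (0 : ℝ) 1, E)))) 0 :=
    analyticAt_id.prod analyticAt_const
  have h1 : AnalyticAt ℝ (fun t : ℝ => (hΨc.localInverse hΨ' (by simp)) (t, 0)) 0 :=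
    AnalyticAt.comp (f := fun t : ℝ => (t, (0 : C(Set.Icc (0 : ℝ) 1, E)))) hLa hta
  have h2 : AnalyticAt ℝ
      (fun t : ℝ => ((hΨc.localInverse hΨ' (by simp)) (t, 0)).2 ⟨1, by simp⟩) 0 :=
    AnalyticAt.comp (g := ((ContinuousMap.evalCLM ℝ (⟨1, by simp⟩ : Set.Icc (0 : ℝ) 1)).comp
      (ContinuousLinearMap.snd ℝ ℝ C(Set.Icc (0 : ℝ) 1, E))))
      (ContinuousLinearMap.analyticAt _ _) h1
  exact (analyticAt_const.add h2).congr hfin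

/-- Solutions of analytic autonomous differential equations are analytic. -/
theorem analyticAt_of_hasDerivAt [CompleteSpace E] {Y : E → E} {c : ℝ → E} {t₀ : ℝ}
    (hY : AnalyticAt ℝ Y (c t₀)) (hc : ∀ᶠ t in 𝓝 t₀, HasDerivAt c (Y (c t)) t) :
    AnalyticAt ℝ c t₀ := by
  have h : AnalyticAt ℝ (fun t => c (t + t₀)) 0 := by
    refine analyticAt_zero_of_hasDerivAt (Y := Y) (by simpa using hY) ?_
    have h0 : Filter.Tendsto (fun t : ℝ => t + t₀) (𝓝 0) (𝓝 t₀) := by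
      have : Continuous fun t : ℝ => t + t₀ := by fun_prop
      simpa using this.tendsto 0
    filter_upwards [h0.eventually hc] with t ht
    exact ht.comp_add_const t t₀
  have h2 : AnalyticAt ℝ (fun t => t - t₀) t₀ := analyticAt_id.sub analyticAt_const
  have h3 := AnalyticAt.comp_of_eq h h2 (sub_self t₀)
  refine h3.congr (Filter.Eventually.of_forall fun t => ?_)
  simp

end AnalyticODE

/-! ### Lipschitz curves and almost everywhere derivatives -/

section Lipschitz

open MeasureTheory

theorem exists_lipschitzOnWith_comp {E F : Type*} [NormedAddCommGroup E] [NormedSpace ℝ E]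
    [ProperSpace E] [NormedAddCommGroup F] [NormedSpace ℝ F] {f : ℝ → E} {φ : E → F} {s : Set ℝ}
    (hs : IsCompact s) (hf : ∃ K, LipschitzOnWith K f s) (hφ : ContDiff ℝ 1 φ) :
    ∃ K, LipschitzOnWith K (fun t => φ (f t)) s := by
  obtain ⟨K, hK⟩ := hf
  obtain ⟨R, hR⟩ := (hs.image_of_continuousOn hK.continuousOn).isBounded.subset_closedBall 0
  obtain ⟨C, hC⟩ := hφ.contDiffOn.exists_lipschitzOnWith one_ne_zero (convex_closedBall 0 R)
    (isCompact_closedBall (0 : E) R)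
  exact ⟨C * K, hC.comp hK (Set.mapsTo_iff_image_subset.2 hR)⟩

theorem eq_of_ae_hasDerivAt_zero {E : Type*} [NormedAddCommGroup E] [NormedSpace ℝ E] {f : ℝ → E}
    {a b : ℝ} (hf : ∃ K, LipschitzOnWith K f (Set.Icc a b))
    (h : ∀ᵐ t ∂volume.restrict (Set.Icc a b), HasDerivAt f 0 t) :
    ∀ t ∈ Set.Icc a b, f t = f a := by
  intro t ht
  have hab : a ≤ b := ht.1.trans ht.2
  obtain ⟨K, hK⟩ := hf
  rw [← Set.uIcc_of_le hab] at hK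
  rw [ae_restrict_iff' measurableSet_Icc, ← Set.uIcc_of_le hab] at h
  obtain ⟨C, hC⟩ := hK.absolutelyContinuousOnInterval.const_of_ae_hasDerivAt_zero h
  rw [Set.uIcc_of_le hab] at hC
  rw [hC t ht, hC a ⟨le_rfl, hab⟩]

theorem le_of_ae_hasDerivAt_nonpos {f f' : ℝ → ℝ} {a b : ℝ}
    (hf : ∃ K, LipschitzOnWith K f (Set.Icc a b))
    (h : ∀ᵐ t ∂volume.restrict (Set.Icc a b), HasDerivAt f (f' t) t ∧ f' t ≤ 0) :
    ∀ t ∈ Set.Icc a b, f t ≤ f a := by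
  intro t ht
  obtain ⟨K, hK⟩ := hf
  have hsub : Set.uIcc a t ⊆ Set.Icc a b := by
    rw [Set.uIcc_of_le ht.1]; exact Set.Icc_subset_Icc_right ht.2
  have h1 := (hK.mono hsub).absolutelyContinuousOnInterval.integral_deriv_eq_sub
  have h2 : ∫ x in a..t, deriv f x ≤ 0 := by
    rw [intervalIntegral.integral_of_le ht.1]
    refine integral_nonpos_of_ae ?_
    refine ae_restrict_of_ae_restrict_of_subset (Set.Ioc_subset_Icc_self.trans
      (Set.Icc_subset_Icc_right ht.2)) ?_
    filter_upwards [h] with x hx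
    rw [hx.1.deriv]
    exact hx.2
  linarith

/-- Uniqueness for Lipschitz solutions of a differential inequality (Gronwall). -/
theorem eq_zero_of_ae_deriv_bound {δ δ' : ℝ → Fin m → ℝ} {L : ℝ}
    (hδ : ∃ K, LipschitzOnWith K δ (Set.Icc 0 1)) (h0 : δ 0 = 0)
    (h : ∀ᵐ t ∂volume.restrict (Set.Icc (0 : ℝ) 1),
      HasDerivAt δ (δ' t) t ∧ ‖δ' t‖ ≤ L * ‖δ t‖) :
    ∀ t ∈ Set.Icc (0 : ℝ) 1, δ t = 0 := by
  -- Each of the `m` terms of the derivative of `∑ δ_i²` is at most `2 L ‖δ‖²` in the sup norm, so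
  -- `exp (-M t) ∑ δ_i²` is nonincreasing.
  set M : ℝ := 2 * m * L
  set φ : ℝ × (Fin m → ℝ) → ℝ := fun p => Real.exp (-M * p.1) * ∑ i, p.2 i ^ 2 with hφ
  have hφs : ContDiff ℝ 1 φ := by
    refine (Real.contDiff_exp.comp (contDiff_const.mul contDiff_fst)).mul ?_
    refine ContDiff.sum fun i _ => ContDiff.pow ?_ 2
    exact (contDiff_apply ℝ ℝ i).comp contDiff_snd
  have hpair : ∃ K, LipschitzOnWith K (fun t => (t, δ t)) (Set.Icc (0 : ℝ) 1) := by
    obtain ⟨K, hK⟩ := hδ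
    exact ⟨_, LipschitzWith.id.lipschitzOnWith.prodMk hK⟩
  have hlip := exists_lipschitzOnWith_comp isCompact_Icc hpair hφs
  have hle := le_of_ae_hasDerivAt_nonpos hlip (f' := fun t =>
    Real.exp (-M * t) * (-M) * (∑ i, δ t i ^ 2) +
      Real.exp (-M * t) * ∑ i, 2 * δ t i * δ' t i) (by
    filter_upwards [h] with t ht
    constructor
    · have h1 : HasDerivAt (fun t => Real.exp (-M * t)) (Real.exp (-M * t) * (-M)) t := by
        simpa using ((hasDerivAt_id t).const_mul (-M)).exp
      have h2 : HasDerivAt (fun t => ∑ i, δ t i ^ 2) (∑ i, 2 * δ t i * δ' t i) t := by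
        refine HasDerivAt.fun_sum fun i _ => ?_
        simpa using ((hasDerivAt_pi.1 ht.1) i).fun_pow 2
      exact h1.mul h2
    · have hsq : ‖δ t‖ ^ 2 ≤ ∑ i, δ t i ^ 2 := by
        have hS : (0 : ℝ) ≤ ∑ i, δ t i ^ 2 := Finset.sum_nonneg fun i _ => sq_nonneg _
        have h1 : ‖δ t‖ ≤ Real.sqrt (∑ i, δ t i ^ 2) := by
          rw [pi_norm_le_iff_of_nonneg (Real.sqrt_nonneg _)]
          intro i
          rw [Real.norm_eq_abs]
          refine Real.abs_le_sqrt ?_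
          exact Finset.single_le_sum (f := fun i => δ t i ^ 2) (fun i _ => sq_nonneg _)
            (Finset.mem_univ i)
        calc ‖δ t‖ ^ 2 ≤ Real.sqrt (∑ i, δ t i ^ 2) ^ 2 := by gcongr
          _ = _ := Real.sq_sqrt hS
      have hterm : ∀ i, 2 * δ t i * δ' t i ≤ 2 * L * ‖δ t‖ ^ 2 := by
        intro i
        have h1 : |δ t i| ≤ ‖δ t‖ := norm_le_pi_norm (δ t) i
        have h2 : |δ' t i| ≤ L * ‖δ t‖ := (norm_le_pi_norm (δ' t) i).trans ht.2
        calc 2 * δ t i * δ' t i ≤ 2 * (|δ t i| * |δ' t i|) := by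
              rw [← abs_mul, mul_assoc]; gcongr; exact le_abs_self _
          _ ≤ 2 * (‖δ t‖ * (L * ‖δ t‖)) := by gcongr
          _ = _ := by ring
      have hsum : ∑ i, 2 * δ t i * δ' t i ≤ M * ‖δ t‖ ^ 2 := by
        refine (Finset.sum_le_sum fun i _ => hterm i).trans (le_of_eq ?_)
        simp only [Finset.sum_const, Finset.card_univ, Fintype.card_fin, nsmul_eq_mul, M]
        ring
      rcases le_or_gt 0 L with hL | hL
      · have hM : 0 ≤ M := by positivity
        have : ∑ i, 2 * δ t i * δ' t i ≤ M * ∑ i, δ t i ^ 2 := hsum.trans (by gcongr)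
        have he := Real.exp_pos (-M * t)
        nlinarith
      · have hz : δ t = 0 := by
          have := (norm_nonneg _).trans ht.2
          have h3 : ‖δ t‖ ≤ 0 := by
            by_contra hc
            push Not at hc
            nlinarith
          exact norm_le_zero_iff.1 h3
        simp [hz])
  intro t ht
  have h1 := hle t ht
  simp only [h0, Pi.zero_apply, hφ] at h1
  have h2 : ∑ i, δ t i ^ 2 ≤ 0 := by
    have he := Real.exp_pos (-M * t)
    by_contra hc
    push Not at hc
    have := mul_pos he hc
    simp only [ne_eq, OfNat.ofNat_ne_zero, not_false_eq_true, zero_pow, Finset.sum_const_zero,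
      mul_zero] at h1
    linarith
  have h3 := (Finset.sum_eq_zero_iff_of_nonneg (fun i _ => sq_nonneg (δ t i))).1
    (le_antisymm h2 (Finset.sum_nonneg fun i _ => sq_nonneg _))
  funext i
  simpa using h3 i (Finset.mem_univ i)

/-- A Lipschitz function whose derivative has constant absolute value almost everywhere is affine
near every point near which it is injective. -/
theorem eventually_affine_of_injOn {τ κ : ℝ → ℝ} {ρ t₀ : ℝ}
    (hτ : ∃ K, LipschitzOnWith K τ (Set.Icc 0 1))
    (hd : ∀ᵐ t ∂volume.restrict (Set.Icc (0 : ℝ) 1), HasDerivAt τ (κ t) t ∧ κ t ^ 2 = ρ)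
    (ht₀ : t₀ ∈ Set.Icc (0 : ℝ) 1) (hinj : ∃ U ∈ nhds t₀, Set.InjOn τ (U ∩ Set.Icc 0 1)) :
    ∃ A B : ℝ, ∀ᶠ t in nhdsWithin t₀ (Set.Icc 0 1), τ t = A * t + B := by
  obtain ⟨U, hU, hinj⟩ := hinj
  obtain ⟨ε, hε, hεU⟩ := Metric.nhds_basis_closedBall.mem_iff.1 hU
  set p := max 0 (t₀ - ε) with hp
  set q := min 1 (t₀ + ε) with hq
  have hpq : p < q := by
    rw [hp, hq, max_lt_iff, lt_min_iff, lt_min_iff]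
    refine ⟨⟨one_pos, ?_⟩, ?_, ?_⟩ <;> linarith [ht₀.1, ht₀.2]
  have hsub : Set.Icc p q ⊆ Set.Icc 0 1 :=
    Set.Icc_subset_Icc (le_max_left _ _) (min_le_left _ _)
  have hsubU : Set.Icc p q ⊆ U := by
    intro t ht
    apply hεU
    rw [Real.closedBall_eq_Icc]
    exact ⟨(le_max_right _ _).trans ht.1, ht.2.trans (min_le_right _ _)⟩
  obtain ⟨K, hK⟩ := hτ
  have hKpq := hK.mono hsub
  have hne : ∀ᵐ t ∂volume.restrict (Set.Icc p q), t ∈ Set.Icc p q :=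
    ae_restrict_mem measurableSet_Icc
  have hdpq := ae_restrict_of_ae_restrict_of_subset hsub hd
  -- A continuous injective function on an interval is strictly monotone; this fixes the sign of the
  -- derivative, whose square is already known.
  have key : ∃ A : ℝ, ∀ᵐ t ∂volume.restrict (Set.Icc p q), HasDerivAt τ A t := by
    rcases hKpq.continuousOn.strictMonoOn_of_injOn_Icc' hpq.le
      (hinj.mono (Set.subset_inter hsubU hsub)) with hmono | hanti
    · refine ⟨Real.sqrt ρ, ?_⟩
      filter_upwards [hdpq, hne] with t ht htm
      have h1 := hmono.monotoneOn.derivWithin_nonneg (x := t)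
      rw [ht.1.hasDerivWithinAt.derivWithin (uniqueDiffOn_Icc hpq t htm)] at h1
      rw [← ht.2, Real.sqrt_sq h1]
      exact ht.1
    · refine ⟨-Real.sqrt ρ, ?_⟩
      filter_upwards [hdpq, hne] with t ht htm
      have h1 := hanti.antitoneOn.derivWithin_nonpos (x := t)
      rw [ht.1.hasDerivWithinAt.derivWithin (uniqueDiffOn_Icc hpq t htm)] at h1
      rw [← ht.2, Real.sqrt_sq_eq_abs, abs_of_nonpos h1, neg_neg]
      exact ht.1
  obtain ⟨A, hA⟩ := key
  have hlin : ∃ K, LipschitzOnWith K (fun t => τ t - A * t) (Set.Icc p q) := by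
    have h2 : LipschitzOnWith ‖A‖₊ (fun t : ℝ => A * t) (Set.Icc p q) :=
      (lipschitzWith_smul A).lipschitzOnWith
    exact ⟨_, hKpq.sub h2⟩
  have hconst := eq_of_ae_hasDerivAt_zero hlin (by
    filter_upwards [hA] with t ht
    exact (ht.fun_sub ((hasDerivAt_id t).const_mul A)).congr_deriv (by simp))
  refine ⟨A, τ p - A * p, ?_⟩
  have hnear : ∀ᶠ t in nhdsWithin t₀ (Set.Icc (0 : ℝ) 1), t ∈ Set.Icc p q := by
    have h1 : Metric.closedBall t₀ ε ∈ nhds t₀ := Metric.closedBall_mem_nhds _ hε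
    filter_upwards [mem_nhdsWithin_of_mem_nhds h1, self_mem_nhdsWithin] with t h2 h3
    rw [Real.closedBall_eq_Icc] at h2
    exact ⟨max_le h3.1 h2.1, le_min h3.2 h2.2⟩
  filter_upwards [hnear] with t ht
  have := hconst t ht
  linarith

end Lipschitz

/-! ### Reparametrization of curves tangent to an analytic vector field -/

section Reparametrization

open MeasureTheory

open scoped Manifold NNReal in
/-- A vector field that is smooth on a neighbourhood of a compact set can be modified away from
it so that it becomes smooth with compact support. -/
theorem exists_compactSupport_extension {E : Type*} [NormedAddCommGroup E] [NormedSpace ℝ E]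
    [FiniteDimensional ℝ E] {Y : E → E} {V S : Set E} (hV : IsOpen V)
    (hY : ∀ x ∈ V, ContDiffAt ℝ 1 Y x) (hS : IsCompact S) (hSV : S ⊆ V) :
    ∃ Z : E → E, ContDiff ℝ 1 Z ∧ HasCompactSupport Z ∧
      ∃ W : Set E, IsOpen W ∧ S ⊆ W ∧ W ⊆ V ∧ Set.EqOn Z Y W := by
  -- The cutoff equals `1` on the inner compact `K₁` and is supported in the outer compact `K₂`.
  obtain ⟨K₂, hK₂, hSK₂, hK₂V⟩ := exists_compact_between hS hV hSV
  obtain ⟨K₁, hK₁, hSK₁, hK₁K₂⟩ := exists_compact_between hS isOpen_interior hSK₂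
  obtain ⟨χ, hχ, -, hχs, hχ1⟩ := exists_contMDiff_support_eq_eq_one_iff (n := ⊤) 𝓘(ℝ, E)
    (isOpen_interior (s := K₂)) hK₁.isClosed hK₁K₂
  have hχd : ContDiff ℝ 1 χ := (contMDiff_iff_contDiff.1 hχ).of_le (by exact_mod_cast le_top)
  have htK : tsupport χ ⊆ K₂ := by
    rw [tsupport, hχs]
    exact closure_minimal interior_subset hK₂.isClosed
  have hZt : tsupport (fun x => χ x • Y x) ⊆ tsupport χ := tsupport_smul_subset_left χ Y
  refine ⟨fun x => χ x • Y x, ?_, ?_, interior K₁, isOpen_interior, hSK₁,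
    (interior_subset.trans hK₁K₂).trans (interior_subset.trans hK₂V), fun x hx => ?_⟩
  · rw [contDiff_iff_contDiffAt]
    intro x
    by_cases hx : x ∈ tsupport χ
    · exact hχd.contDiffAt.smul (hY x (hK₂V (htK hx)))
    · have h0 : (fun x => χ x • Y x) =ᶠ[nhds x] fun _ => 0 :=
        notMem_tsupport_iff_eventuallyEq.1 fun h => hx (hZt h)
      exact contDiffAt_const.congr_of_eventuallyEq h0
  · exact hK₂.of_isClosed_subset (isClosed_tsupport _) (hZt.trans htK)
  · simp only
    rw [(hχ1 x).1 (interior_subset hx), one_smul]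

theorem exists_primitive {κ : ℝ → ℝ} {B : ℝ}
    (hκm : AEStronglyMeasurable κ (volume.restrict (Set.Icc 0 1)))
    (hκB : ∀ᵐ t ∂volume.restrict (Set.Icc (0 : ℝ) 1), |κ t| ≤ B) :
    ∃ τ : ℝ → ℝ, τ 0 = 0 ∧ (∃ K, LipschitzOnWith K τ (Set.Icc 0 1)) ∧
      (∀ t ∈ Set.Icc (0 : ℝ) 1, |τ t| ≤ B) ∧
      ∀ᵐ t ∂volume.restrict (Set.Icc (0 : ℝ) 1), HasDerivAt τ (κ t) t := by
  have hB : 0 ≤ B := by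
    have hne : (ae (volume.restrict (Set.Icc (0 : ℝ) 1))).NeBot := by
      rw [ae_restrict_neBot]; simp
    obtain ⟨t, ht⟩ := hκB.exists
    exact (abs_nonneg _).trans ht
  have hint : IntegrableOn κ (Set.Icc 0 1) :=
    Integrable.of_bound hκm B hκB
  have hii : IntervalIntegrable κ volume 0 1 := by
    rw [intervalIntegrable_iff_integrableOn_Icc_of_le zero_le_one]; exact hint
  have hsub : ∀ s ∈ Set.Icc (0 : ℝ) 1, ∀ t ∈ Set.Icc (0 : ℝ) 1, IntervalIntegrable κ volume s t :=
    fun s hs t ht => hii.mono_set (by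
      rw [Set.uIcc_of_le (zero_le_one' ℝ)]; exact Set.uIcc_subset_Icc hs ht)
  have h0 : (0 : ℝ) ∈ Set.Icc (0 : ℝ) 1 := ⟨le_rfl, zero_le_one⟩
  have hle : ∀ s ∈ Set.Icc (0 : ℝ) 1, ∀ t ∈ Set.Icc (0 : ℝ) 1,
      |∫ x in s..t, κ x| ≤ B * |t - s| := by
    intro s hs t ht
    rw [← Real.norm_eq_abs]
    refine intervalIntegral.norm_integral_le_of_norm_le_const_ae ?_
    rw [ae_restrict_iff' measurableSet_Icc] at hκB
    filter_upwards [hκB] with x hx hxm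
    exact hx (Set.uIcc_subset_Icc hs ht (Set.uIoc_subset_uIcc hxm))
  refine ⟨fun t => ∫ x in (0 : ℝ)..t, κ x, by simp, ⟨B.toNNReal, ?_⟩, ?_, ?_⟩
  · refine LipschitzOnWith.of_dist_le_mul fun s hs t ht => ?_
    rw [Real.dist_eq, Real.dist_eq, Real.coe_toNNReal _ hB,
      intervalIntegral.integral_interval_sub_left (hsub 0 h0 s hs) (hsub 0 h0 t ht)]
    exact hle t ht s hs
  · intro t ht
    refine (hle 0 h0 t ht).trans ?_
    rw [sub_zero, abs_of_nonneg ht.1]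
    exact mul_le_of_le_one_right hB ht.2
  · rw [ae_restrict_iff' measurableSet_Icc]
    filter_upwards [hii.ae_hasDerivAt_integral] with x hx hxm
    rw [Set.uIcc_of_le (zero_le_one' ℝ)] at hx
    exact hx hxm 0 h0

open scoped NNReal in
-- A globally bounded and Lipschitz field satisfies the Picard–Lindelöf conditions on any `[-T, T]`:
-- the ball of radius `B T` cannot be left in time `T`.
theorem exists_solution_of_compactSupport {E : Type*} [NormedAddCommGroup E] [NormedSpace ℝ E]
    [CompleteSpace E] {Z : E → E} {C : ℝ≥0} (hZ : LipschitzWith C Z) {B : ℝ}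
    (hB : ∀ x, ‖Z x‖ ≤ B) (x₀ : E) {T : ℝ} (hT : 0 ≤ T) :
    ∃ c : ℝ → E, c 0 = x₀ ∧ ∀ σ ∈ Set.Icc (-T) T,
      HasDerivWithinAt c (Z (c σ)) (Set.Icc (-T) T) σ := by
  have hB0 : 0 ≤ B := (norm_nonneg _).trans (hB x₀)
  have h0 : (0 : ℝ) ∈ Set.Icc (-T) T := ⟨by linarith, hT⟩
  have hPL : IsPicardLindelof (fun _ => Z) (⟨0, h0⟩ : Set.Icc (-T) T) x₀ (B * T).toNNReal 0
      B.toNNReal C := by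
    refine IsPicardLindelof.of_time_independent (fun x _ => ?_) hZ.lipschitzOnWith ?_
    · rw [Real.coe_toNNReal _ hB0]; exact hB x
    · rw [Real.coe_toNNReal _ hB0, Real.coe_toNNReal _ (by positivity)]
      simp
  exact hPL.exists_eq_forall_mem_Icc_hasDerivWithinAt₀

/-- A Lipschitz curve whose velocity is almost everywhere a multiple of an analytic vector field
is a Lipschitz reparametrization of an integral curve of that vector field. -/
theorem exists_analytic_reparametrization {γ : ℝ → Fin m → ℝ} {κ : ℝ → ℝ}
    {Y : (Fin m → ℝ) → Fin m → ℝ} {V : Set (Fin m → ℝ)} {B : ℝ} (hV : IsOpen V)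
    (hY : ∀ x ∈ V, AnalyticAt ℝ Y x) (hγ : ∃ K, LipschitzOnWith K γ (Set.Icc 0 1))
    (hγV : ∀ t ∈ Set.Icc (0 : ℝ) 1, γ t ∈ V)
    (hκm : AEStronglyMeasurable κ (volume.restrict (Set.Icc 0 1)))
    (hκB : ∀ᵐ t ∂volume.restrict (Set.Icc (0 : ℝ) 1), |κ t| ≤ B)
    (hγ' : ∀ᵐ t ∂volume.restrict (Set.Icc (0 : ℝ) 1), HasDerivAt γ (κ t • Y (γ t)) t) :
    ∃ (a b : ℝ) (c : ℝ → Fin m → ℝ) (τ : ℝ → ℝ),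
      AnalyticOnNhd ℝ c (Set.Ioo a b) ∧
      (∀ σ ∈ Set.Ioo a b, c σ ∈ V ∧ HasDerivAt c (Y (c σ)) σ) ∧
      (∃ K, LipschitzOnWith K τ (Set.Icc 0 1)) ∧
      Set.MapsTo τ (Set.Icc 0 1) (Set.Ioo a b) ∧
      (∀ t ∈ Set.Icc (0 : ℝ) 1, γ t = c (τ t)) ∧
      ∀ᵐ t ∂volume.restrict (Set.Icc (0 : ℝ) 1), HasDerivAt τ (κ t) t := by
  obtain ⟨τ, hτ0, hτL, hτB, hτ'⟩ := exists_primitive hκm hκB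
  have hγc : ContinuousOn γ (Set.Icc 0 1) := hγ.choose_spec.continuousOn
  have hτc : ContinuousOn τ (Set.Icc 0 1) := hτL.choose_spec.continuousOn
  have h0 : (0 : ℝ) ∈ Set.Icc (0 : ℝ) 1 := ⟨le_rfl, zero_le_one⟩
  have hB : 0 ≤ B := (abs_nonneg _).trans (hτB 0 h0)
  obtain ⟨Z, hZ, hZs, W, hW, hSW, hWV, hZY⟩ := exists_compactSupport_extension hV
    (fun x hx => (hY x hx).contDiffAt) (isCompact_Icc.image_of_continuousOn hγc)
    (Set.mapsTo_iff_image_subset.1 hγV)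
  obtain ⟨C, hC⟩ := hZ.lipschitzWith_of_hasCompactSupport hZs one_ne_zero
  obtain ⟨D, hD⟩ := hZs.exists_bound_of_continuous hZ.continuous
  have hD0 : 0 ≤ D := (norm_nonneg _).trans (hD 0)
  -- Since `|τ| ≤ B`, the values of `τ` stay in the open interval, where `c` has two-sided
  -- derivatives.
  set T : ℝ := B + 1 with hT
  obtain ⟨c, hc0, hc⟩ := exists_solution_of_compactSupport hC hD (γ 0) (T := T) (by positivity)
  have hτI : ∀ t ∈ Set.Icc (0 : ℝ) 1, τ t ∈ Set.Ioo (-T) T := by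
    intro t ht
    have := abs_le.1 (hτB t ht)
    constructor <;> linarith [this.1, this.2]
  have hcI : ∀ σ ∈ Set.Ioo (-T) T, HasDerivAt c (Z (c σ)) σ := fun σ hσ =>
    (hc σ (Set.Ioo_subset_Icc_self hσ)).hasDerivAt (Icc_mem_nhds hσ.1 hσ.2)
  have hcL : LipschitzOnWith D.toNNReal c (Set.Icc (-T) T) := by
    refine Convex.lipschitzOnWith_of_nnnorm_hasDerivWithin_le (convex_Icc _ _) hc fun σ _ => ?_
    rw [← NNReal.coe_le_coe, Real.coe_toNNReal _ hD0]
    exact hD _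
  have heq : ∀ t ∈ Set.Icc (0 : ℝ) 1, γ t = c (τ t) := by
    have hlip : ∃ K, LipschitzOnWith K (fun t => γ t - c (τ t)) (Set.Icc 0 1) := by
      obtain ⟨K₁, h1⟩ := hγ
      obtain ⟨K₂, h2⟩ := hτL
      exact ⟨_, h1.sub (hcL.comp h2 fun t ht => Set.Ioo_subset_Icc_self (hτI t ht))⟩
    -- Both `γ` and `c ∘ τ` solve `x' = κ(t) Z(x)`, because `Z = Y` on the image of `γ`; the right
    -- side is Lipschitz in `x` with constant `B C`.
    have h := eq_zero_of_ae_deriv_bound (L := B * C) (δ := fun t => γ t - c (τ t))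
      (δ' := fun t => κ t • Y (γ t) - κ t • Z (c (τ t))) hlip (by simp [hτ0, hc0]) (by
        filter_upwards [hγ', hτ', hκB, ae_restrict_mem measurableSet_Icc] with t h1 h2 h3 ht
        refine ⟨h1.fun_sub ((hcI _ (hτI t ht)).scomp t h2), ?_⟩
        rw [← hZY (hSW ⟨t, ht, rfl⟩), ← smul_sub, norm_smul, Real.norm_eq_abs, mul_assoc]
        gcongr
        exact hC.norm_sub_le _ _)
    intro t ht
    exact sub_eq_zero.1 (h t ht)
  -- On these times `c` follows the analytic field `Y` itself. The image of `τ` is a compact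
  -- interval in `O`, so it can be slightly enlarged inside `O`.
  set O : Set ℝ := {σ | σ ∈ Set.Ioo (-T) T ∧ c σ ∈ W} with hO
  have hOo : IsOpen O :=
    ContinuousOn.isOpen_inter_preimage
      (fun σ hσ => (hcI σ hσ).continuousAt.continuousWithinAt) isOpen_Ioo hW
  have hSO : τ '' Set.Icc 0 1 ⊆ O := by
    rintro _ ⟨t, ht, rfl⟩
    exact ⟨hτI t ht, by rw [← heq t ht]; exact hSW ⟨t, ht, rfl⟩⟩
  have hScomp : IsCompact (τ '' Set.Icc 0 1) := isCompact_Icc.image_of_continuousOn hτc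
  have hSne : (τ '' Set.Icc 0 1).Nonempty := ⟨_, 0, h0, rfl⟩
  have hSconn : (τ '' Set.Icc 0 1).OrdConnected :=
    (isPreconnected_Icc.image τ hτc).ordConnected
  obtain ⟨ε, hε, hεO⟩ := hScomp.exists_thickening_subset_open hOo hSO
  obtain ⟨p, hp, hpmin⟩ := hScomp.exists_isLeast hSne
  obtain ⟨q, hq, hqmax⟩ := hScomp.exists_isGreatest hSne
  have hsubO : Set.Ioo (p - ε) (q + ε) ⊆ O := by
    intro σ hσ
    apply hεO
    rw [Metric.mem_thickening_iff]
    rcases lt_or_ge σ p with h1 | h1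
    · exact ⟨p, hp, by rw [Real.dist_eq, abs_lt]; constructor <;> linarith [hσ.1]⟩
    rcases lt_or_ge q σ with h2 | h2
    · exact ⟨q, hq, by rw [Real.dist_eq, abs_lt]; constructor <;> linarith [hσ.2]⟩
    · exact ⟨σ, hSconn.out hp hq ⟨h1, h2⟩, by simpa using hε⟩
  have hcO : ∀ σ ∈ O, HasDerivAt c (Y (c σ)) σ := by
    intro σ hσ
    rw [← hZY hσ.2]
    exact hcI σ hσ.1
  refine ⟨p - ε, q + ε, c, τ, ?_, ?_, hτL, ?_, heq, hτ'⟩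
  · intro σ hσ
    refine analyticAt_of_hasDerivAt (hY _ (hWV (hsubO hσ).2)) ?_
    filter_upwards [hOo.mem_nhds (hsubO hσ)] with r hr
    exact hcO r hr
  · intro σ hσ
    exact ⟨hWV (hsubO hσ).2, hcO σ (hsubO hσ)⟩
  · intro t ht
    exact ⟨by linarith [hpmin ⟨t, ht, rfl⟩], by linarith [hqmax ⟨t, ht, rfl⟩]⟩

end Reparametrization

/-- The dot product as a continuous bilinear map. -/
def dotCLM (m : ℕ) : (Fin m → ℝ) →L[ℝ] (Fin m → ℝ) →L[ℝ] ℝ :=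
  ∑ k, (ContinuousLinearMap.proj (R := ℝ) (φ := fun _ : Fin m => ℝ) k).smulRight
    (ContinuousLinearMap.proj (R := ℝ) (φ := fun _ : Fin m => ℝ) k)

theorem dotCLM_apply (v w : Fin m → ℝ) : dotCLM m v w = v ⬝ᵥ w := by
  simp [dotCLM, dotProduct]

theorem sum_smul_stdVec (u : Fin m → ℝ) : ∑ k, u k • stdVec k = u := by
  funext i
  simp [stdVec, Pi.single_apply]

theorem stdVec_ne_zero (k : Fin m) : stdVec k ≠ 0 := by
  intro h
  simpa [stdVec] using congrFun h k

theorem linearIndependent_stdVec : LinearIndependent ℝ (stdVec : Fin m → Fin m → ℝ) := by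
  have : (stdVec : Fin m → Fin m → ℝ) = Pi.basisFun ℝ (Fin m) := by
    funext k; simp [stdVec]
  rw [this]
  exact (Pi.basisFun ℝ (Fin m)).linearIndependent

/-! ### The layers of a stratified algebra of rank two -/

theorem layer_eq_span_range (d : Fin m → ℕ) (i : ℕ) :
    layer d i = Submodule.span ℝ (Set.range fun k : {k : Fin m // d k = i} => stdVec k.1) := by
  rw [layer]
  congr 1
  ext u
  constructor
  · rintro ⟨k, hk, rfl⟩; exact ⟨⟨k, hk⟩, rfl⟩
  · rintro ⟨k, rfl⟩; exact ⟨k.1, k.2, rfl⟩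

theorem finrank_layer (d : Fin m → ℕ) (i : ℕ) :
    Module.finrank ℝ (layer d i) = Fintype.card {k : Fin m // d k = i} := by
  rw [layer_eq_span_range, finrank_span_eq_card]
  exact linearIndependent_stdVec.comp _ Subtype.val_injective

/-- In a stratified algebra of rank two and step at least three the second layer is spanned by the
third basis vector. -/
theorem LieGroupLaw.IsStratified.rank_two {G : LieGroupLaw m} {d : Fin m → ℕ} {s : ℕ}
    (hd : G.IsStratified d s) (hrank : Module.finrank ℝ (layer d 1) = 2) (hs : 3 ≤ s) :
    ∃ j₀ j₁ : HorIdx d, j₀ ≠ j₁ ∧ (∀ j, j = j₀ ∨ j = j₁) ∧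
      ∃ i : Fin m, (i : ℕ) = 2 ∧ layer d 2 = Submodule.span ℝ {stdVec i} := by
  have hcard : (Finset.univ : Finset (HorIdx d)).card = 2 := by
    rw [Finset.card_univ, ← hrank, finrank_layer]
  obtain ⟨j₀, j₁, hne, huniv⟩ := Finset.card_eq_two.1 hcard
  have hj : ∀ j, j = j₀ ∨ j = j₁ := by
    intro j
    have := Finset.mem_univ j
    rw [huniv] at this
    simpa using this
  have hle : layer d 2 ≤ Submodule.span ℝ {G.bracket (stdVec j₀.1) (stdVec j₁.1)} := by
    have hmem : ∀ u ∈ layer d 1, ∃ a b : ℝ, u = a • stdVec j₀.1 + b • stdVec j₁.1 := by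
      intro u hu
      have h1 : layer d 1 ≤ Submodule.span ℝ {stdVec j₀.1, stdVec j₁.1} := by
        rw [layer, Submodule.span_le]
        rintro _ ⟨k, hk, rfl⟩
        apply Submodule.subset_span
        rcases hj ⟨k, hk⟩ with h | h
        · left; rw [← h]
        · right; rw [← h]; rfl
      obtain ⟨a, b, h⟩ := Submodule.mem_span_pair.1 (h1 hu)
      exact ⟨a, b, h.symm⟩
    rw [hd.layer_succ 1 le_rfl, Submodule.span_le]
    rintro _ ⟨u, hu, w, hw, rfl⟩
    obtain ⟨a, b, rfl⟩ := hmem u hu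
    obtain ⟨a', b', rfl⟩ := hmem w hw
    have hself : ∀ x, G.bracket x x = 0 := fun x => by simp [G.bracket_eq]
    refine Submodule.mem_span_singleton.2 ⟨a * b' - b * a', ?_⟩
    rw [← G.ad_apply (a • _ + _)]
    simp only [map_add, map_smul, add_apply, smul_apply, G.ad_apply, hself,
      G.bracket_swap (stdVec j₁.1) (stdVec j₀.1)]
    module
  have hcard2 : Fintype.card {k : Fin m // d k = 2} ≤ 1 := by
    rw [← finrank_layer]
    exact (Submodule.finrank_mono hle).trans
      ((finrank_span_le_card _).trans (by simp))
  obtain ⟨i, hi⟩ : ∃ i, d i = 2 := by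
    by_contra hno
    push Not at hno
    -- If the second layer were empty, all later ones would vanish, against step at least three.
    have hbot : ∀ n, layer d (n + 2) = ⊥ := by
      intro n
      induction n with
      | zero =>
        rw [layer, Submodule.span_eq_bot]
        rintro _ ⟨k, hk, rfl⟩
        exact absurd hk (hno k)
      | succ n ih =>
        rw [show n + 1 + 2 = (n + 2) + 1 by ring, hd.layer_succ _ (by omega),
          Submodule.span_eq_bot]
        rintro _ ⟨u, -, w, hw, rfl⟩
        rw [ih, Submodule.mem_bot] at hw
        rw [hw, ← G.ad_apply, map_zero]
    obtain ⟨k, hk⟩ := hd.step_attained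
    have h1 := LieGroupLaw.stdVec_mem_layer d k
    rw [hk, show s = (s - 2) + 2 by omega, hbot, Submodule.mem_bot] at h1
    exact stdVec_ne_zero k h1
  have huniq : ∀ k, d k = 2 → k = i := fun k hk =>
    congrArg Subtype.val ((Fintype.card_le_one_iff.1 hcard2) ⟨k, hk⟩ ⟨i, hi⟩)
  refine ⟨j₀, j₁, hne, hj, i, ?_, ?_⟩
  -- Indices start at `0`, so the value of `i` counts its predecessors. By monotonicity of `d` these
  -- are the two horizontal indices.
  · have h1 : Finset.Iio i = Finset.univ.filter fun k => d k = 1 := by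
      ext k
      simp only [Finset.mem_Iio, Finset.mem_filter, Finset.mem_univ, true_and]
      constructor
      · intro hk
        have h2 := hd.mono hk.le
        have h3 := hd.one_le k
        have h4 : d k ≠ 2 := fun h => hk.ne (huniq k h)
        omega
      · intro hk
        by_contra hc
        have := hd.mono (not_lt.1 hc)
        omega
    rw [← Fin.card_Iio, h1, ← Fintype.card_subtype, ← finrank_layer, hrank]
  · rw [layer]
    congr 1
    ext u
    constructor
    · rintro ⟨k, hk, rfl⟩; rw [huniq k hk]; rfl
    · rintro rfl; exact ⟨i, hi, rfl⟩

/-! ### Linear algebra of the transversality condition -/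

/-- The intersection is the line of the rotated vector `-L(X₁) X₀ + L(X₀) X₁`. -/
theorem finrank_ker_inf_span_pair {E ι : Type*} [NormedAddCommGroup E] [NormedSpace ℝ E]
    (L : E →L[ℝ] ℝ) (X : ι → E) (j₀ j₁ : ι) (hj : ∀ j, j = j₀ ∨ j = j₁)
    (hX : ∀ a b : ℝ, a • X j₀ + b • X j₁ = 0 → a = 0 ∧ b = 0)
    (hL : L (X j₀) ^ 2 + L (X j₁) ^ 2 ≠ 0) :
    Module.finrank ℝ ↥(L.ker ⊓ Submodule.span ℝ (Set.range X)) = 1 := by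
  set y := (-L (X j₁)) • X j₀ + L (X j₀) • X j₁ with hy
  have hy0 : y ≠ 0 := by
    intro h
    obtain ⟨h1, h2⟩ := hX _ _ h
    apply hL
    rw [h2, neg_eq_zero.1 h1]
    ring
  have hrange : Set.range X = {X j₀, X j₁} := by
    ext u
    constructor
    · rintro ⟨j, rfl⟩
      rcases hj j with rfl | rfl <;> simp
    · rintro (rfl | rfl) <;> exact ⟨_, rfl⟩
  have hspan : L.ker ⊓ Submodule.span ℝ (Set.range X) = Submodule.span ℝ {y} := by
    rw [hrange]
    ext u
    simp only [Submodule.mem_inf, Submodule.mem_span_pair, Submodule.mem_span_singleton]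
    constructor
    · rintro ⟨hu, a, b, rfl⟩
      have hu' : a * L (X j₀) + b * L (X j₁) = 0 := by
        have : L (a • X j₀ + b • X j₁) = 0 := hu
        simpa using this
      refine ⟨(b * L (X j₀) - a * L (X j₁)) / (L (X j₀) ^ 2 + L (X j₁) ^ 2), ?_⟩
      rw [hy, smul_add, smul_smul, smul_smul]
      congr 2
      · field_simp
        linear_combination (-L (X j₀)) * hu'
      · field_simp
        linear_combination (-L (X j₁)) * hu'
    · rintro ⟨a, rfl⟩
      refine ⟨?_, a * -L (X j₁), a * L (X j₀), ?_⟩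
      · change L (a • y) = 0
        rw [hy]
        simp
        ring
      · rw [hy, smul_add, smul_smul, smul_smul]
  rw [hspan, finrank_span_singleton hy0]

/-! ### The dual curve as the coadjoint action on a constant covector -/

namespace LieGroupLaw

variable (G : LieGroupLaw m)

theorem fderiv_leftDiff_sub (x u w : Fin m → ℝ) :
    fderiv ℝ G.leftDiff x (G.leftDiff x w) u - fderiv ℝ G.leftDiff x (G.leftDiff x u) w =
      G.leftDiff x (G.bracket w u) := by
  have h := G.lieBracket_leftInv w u x
  simpa only [VectorField.lieBracket, fderiv_leftInv, leftInv_eq] using h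

theorem leftDiff_injective (x : Fin m → ℝ) : Function.Injective (G.leftDiff x) := by
  have h := G.leftDiff_mul (G.inv x) x
  rw [G.inv_mul, leftDiff_zero] at h
  refine Function.LeftInverse.injective (g := fderiv ℝ (G.mul (G.inv x)) x) fun u => ?_
  exact (congrArg (fun L => L u) h).symm

theorem contDiff_Ad_inv : ContDiff ℝ ∞ fun x => G.Ad (G.inv x) :=
  G.contDiff_Ad.comp G.contDiff_inv

/-- Differentiate `Ad(x⁻¹) Ad(x) = id`, and use the known derivative of `Ad`. -/
theorem fderiv_Ad_inv_leftDiff (x w z : Fin m → ℝ) :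
    fderiv ℝ (fun y => G.Ad (G.inv y)) x (G.leftDiff x w) z =
      -G.bracket w (G.Ad (G.inv x) z) := by
  have h1 := ((G.contDiff_Ad_inv.differentiable (by simp)) x).hasFDerivAt.clm_comp
    (G.differentiable_Ad x).hasFDerivAt
  have h2 := h1.unique ((hasFDerivAt_const (ContinuousLinearMap.id ℝ (Fin m → ℝ))
    x).congr_of_eventuallyEq (Filter.Eventually.of_forall G.Ad_inv_comp))
  have h3 := congrArg (fun L => L (G.leftDiff x w) (G.Ad (G.inv x) z)) h2
  have h4 : ∀ u, G.Ad x (G.Ad (G.inv x) u) = u := fun u =>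
    congrArg (fun L => L u) (G.Ad_comp_inv x)
  have h5 : ∀ u, G.Ad (G.inv x) (G.Ad x u) = u := fun u =>
    congrArg (fun L => L u) (G.Ad_inv_comp x)
  simp [fderiv_Ad_leftDiff, h4, h5] at h3
  rw [eq_neg_iff_add_eq_zero, add_comm]
  exact h3

/-- The velocity at the identity of a horizontal curve with controls `h`. -/
def controlVec (d : Fin m → ℕ) (h : HorIdx d → ℝ) : Fin m → ℝ := ∑ j, h j • stdVec j.1

theorem leftDiff_controlVec (d : Fin m → ℕ) (h : HorIdx d → ℝ) (x : Fin m → ℝ) :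
    G.leftDiff x (controlVec d h) = ∑ j, h j • G.hor d j x := by
  simp only [controlVec, map_sum, map_smul]
  rfl

theorem adjoint_dotProduct (d : Fin m → ℕ) (h : HorIdx d → ℝ) (x ζ y : Fin m → ℝ) :
    (fun k => -∑ j, ∑ i, fderiv ℝ (G.hor d j) x (stdVec k) i * h j * ζ i) ⬝ᵥ y =
      -(ζ ⬝ᵥ fderiv ℝ G.leftDiff x y (controlVec d h)) := by
  have h1 : fderiv ℝ G.leftDiff x y (controlVec d h) =
      ∑ j, h j • fderiv ℝ (G.hor d j) x y := by
    simp only [controlVec, map_sum, map_smul]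
    refine Finset.sum_congr rfl fun j _ => ?_
    rw [← fderiv_leftInv]
    rfl
  have h2 : ∀ j : HorIdx d, fderiv ℝ (G.hor d j) x y =
      ∑ k, y k • fderiv ℝ (G.hor d j) x (stdVec k) := by
    intro j
    conv_lhs => rw [← sum_smul_stdVec y]
    simp only [map_sum, map_smul]
  rw [h1]
  simp only [h2, dotProduct_sum, dotProduct_smul, smul_eq_mul]
  simp only [dotProduct, neg_mul, Finset.sum_neg_distrib, Finset.sum_mul, Finset.mul_sum]
  rw [Finset.sum_comm]
  congr 1
  refine Finset.sum_congr rfl fun j _ => Finset.sum_congr rfl fun k _ =>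
    Finset.sum_congr rfl fun i _ => by ring

theorem contDiff_dual (z : Fin m → ℝ) :
    ContDiff ℝ ∞ fun p : (Fin m → ℝ) × (Fin m → ℝ) =>
      dotCLM m p.1 (G.leftDiff p.2 (G.Ad (G.inv p.2) z)) := by
  have h1 : ContDiff ℝ ∞ fun p : (Fin m → ℝ) × (Fin m → ℝ) => dotCLM m p.1 :=
    (dotCLM m).contDiff.comp contDiff_fst
  have h2 : ContDiff ℝ ∞ fun p : (Fin m → ℝ) × (Fin m → ℝ) => G.leftDiff p.2 :=
    G.contDiff_leftDiff.comp contDiff_snd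
  have h3 : ContDiff ℝ ∞ fun p : (Fin m → ℝ) × (Fin m → ℝ) => G.Ad (G.inv p.2) z :=
    (G.contDiff_Ad_inv.comp contDiff_snd).clm_apply contDiff_const
  exact h1.clm_apply (h2.clm_apply h3)

/-- The vector `leftDiff x (Ad(x⁻¹) z)` is the value at `x` of the right-invariant field extending
`z`. Its pairing with `ξ` has zero derivative almost everywhere: the adjoint equation and the motion
of the frame leave a bracket, which the derivative of `Ad(x⁻¹)` cancels. Being Lipschitz, the
pairing is constant, and `v` collects these constants. -/
theorem exists_dual_eq_coadjoint {d : Fin m → ℕ} {γ : ℝ → Fin m → ℝ} {h : ℝ → HorIdx d → ℝ}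
    {ξ : ℝ → Fin m → ℝ} (hγ : IsHorizontalCurve (G.hor d) γ h)
    (hξ : ∃ K, LipschitzOnWith K ξ (Set.Icc 0 1)) (had : SolvesAdjoint (G.hor d) γ h ξ) :
    ∃ v : Fin m → ℝ, ∀ t ∈ Set.Icc (0 : ℝ) 1, ∀ u,
      ξ t ⬝ᵥ G.leftDiff (γ t) u = v ⬝ᵥ G.Ad (γ t) u := by
  have hconst : ∀ z, ∀ t ∈ Set.Icc (0 : ℝ) 1,
      dotCLM m (ξ t) (G.leftDiff (γ t) (G.Ad (G.inv (γ t)) z)) =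
      dotCLM m (ξ 0) (G.leftDiff (γ 0) (G.Ad (G.inv (γ 0)) z)) := by
    intro z
    refine eq_of_ae_hasDerivAt_zero
      (f := fun t => dotCLM m (ξ t) (G.leftDiff (γ t) (G.Ad (G.inv (γ t)) z))) ?_ ?_
    · have hpair : ∃ K, LipschitzOnWith K (fun t => (ξ t, γ t)) (Set.Icc (0 : ℝ) 1) := by
        obtain ⟨K₁, h1⟩ := hξ
        obtain ⟨K₂, h2⟩ := hγ.lipschitz
        exact ⟨_, h1.prodMk h2⟩
      exact exists_lipschitzOnWith_comp (E := (Fin m → ℝ) × (Fin m → ℝ)) (F := ℝ)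
        (f := fun t => (ξ t, γ t)) isCompact_Icc hpair
        ((G.contDiff_dual z).of_le (WithTop.coe_le_coe.2 le_top))
    · filter_upwards [hγ.hasDerivAt, had] with t h1 h2
      rw [← leftDiff_controlVec] at h1
      set w := controlVec d (h t)
      have e1 := (dotCLM m).hasFDerivAt.comp_hasDerivAt t h2
      have e2 := (G.differentiable_leftDiff (γ t)).hasFDerivAt.comp_hasDerivAt t h1
      have e3 := ((G.contDiff_Ad_inv.differentiable (by simp)) (γ t)).hasFDerivAt.comp_hasDerivAt
        t h1
      have e4 := e1.clm_apply (e2.clm_apply (e3.clm_apply (hasDerivAt_const t z)))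
      refine e4.congr_deriv ?_
      simp only [Function.comp_apply, map_zero, add_zero, dotCLM_apply]
      rw [adjoint_dotProduct, fderiv_Ad_inv_leftDiff, map_neg,
        ← G.fderiv_leftDiff_sub (γ t) (G.Ad (G.inv (γ t)) z) w]
      simp only [dotProduct_add, dotProduct_neg, dotProduct_sub]
      ring
  refine ⟨fun k => dotCLM m (ξ 0) (G.leftDiff (γ 0) (G.Ad (G.inv (γ 0)) (stdVec k))),
    fun t ht u => ?_⟩
  have hv : ∀ z, (fun k => dotCLM m (ξ 0) (G.leftDiff (γ 0) (G.Ad (G.inv (γ 0)) (stdVec k)))) ⬝ᵥ z =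
      dotCLM m (ξ 0) (G.leftDiff (γ 0) (G.Ad (G.inv (γ 0)) z)) := by
    intro z
    conv_rhs => rw [← sum_smul_stdVec z]
    simp only [map_sum, map_smul, dotProduct, smul_eq_mul]
    exact Finset.sum_congr rfl fun k _ => mul_comm _ _
  rw [hv, ← hconst _ t ht, dotCLM_apply]
  congr 2
  exact (congrArg (fun L => L u) (G.Ad_inv_comp (γ t))).symm

end LieGroupLaw

theorem sum_eq_add_of_pair {ι M : Type*} [Fintype ι] [AddCommMonoid M] {j₀ j₁ : ι} (hne : j₀ ≠ j₁)
    (hj : ∀ j, j = j₀ ∨ j = j₁) (F : ι → M) : ∑ j, F j = F j₀ + F j₁ := by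
  classical
  have h : (Finset.univ : Finset ι) = {j₀, j₁} := by
    ext j; simpa using hj j
  rw [h, Finset.sum_pair hne]

/-! ### Horizontal gradient of the extremal polynomial and the unit speed reparametrization -/

namespace LieGroupLaw

open MeasureTheory

variable (G : LieGroupLaw m)

variable {G}

theorem IsSecondType.analyticAt_dotProduct_Ad (hG : G.IsSecondType) (v u x : Fin m → ℝ) :
    AnalyticAt ℝ (fun x => v ⬝ᵥ G.Ad x u) x := by
  simp only [← dotCLM_apply]
  have h1 : ContDiffAt ℝ ω (fun x => G.Ad x u) x :=
    ((hG.analyticAt_Ad x).contDiffAt).clm_apply contDiffAt_const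
  exact ((dotCLM m v).contDiff.contDiffAt.comp x h1).analyticAt

theorem IsSecondType.analyticAt_leftDiff_apply (hG : G.IsSecondType) (u x : Fin m → ℝ) :
    AnalyticAt ℝ (fun x => G.leftDiff x u) x :=
  (((hG.analyticAt_leftDiff x).contDiffAt (n := ω)).clm_apply contDiffAt_const).analyticAt

variable (G)

theorem fderiv_dotProduct_Ad_leftDiff (v u w x : Fin m → ℝ) :
    fderiv ℝ (fun x => v ⬝ᵥ G.Ad x u) x (G.leftDiff x w) = v ⬝ᵥ G.Ad x (G.bracket w u) := by
  have h : HasFDerivAt (fun x => dotCLM m v (G.Ad x u)) _ x :=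
    (dotCLM m v).hasFDerivAt.comp x
      ((G.differentiable_Ad x).hasFDerivAt.clm_apply (hasFDerivAt_const u x))
  simp only [dotCLM_apply] at h
  rw [h.fderiv]
  simp [dotCLM_apply, fderiv_Ad_leftDiff]

variable {G}

/-- The Goh condition makes the components of the dual curve along the second layer vanish. -/
theorem IsStratified.dual_layer_two_eq_zero {d : Fin m → ℕ} {s : ℕ} (hd : G.IsStratified d s)
    {x ζ : Fin m → ℝ}
    (hgoh : ∀ i j, ζ ⬝ᵥ VectorField.lieBracket ℝ (G.hor d i) (G.hor d j) x = 0)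
    {z : Fin m → ℝ} (hz : z ∈ layer d 2) : ζ ⬝ᵥ G.leftDiff x z = 0 := by
  have hpair : ∀ k l, d k = 1 → d l = 1 →
      dotCLM m ζ (G.leftDiff x (G.ad (stdVec k) (stdVec l))) = 0 := by
    intro k l hk hl
    have h := hgoh ⟨k, hk⟩ ⟨l, hl⟩
    rw [dotCLM_apply, ad_apply, ← leftInv_eq, ← lieBracket_leftInv]
    exact h
  have hbil : ∀ u ∈ layer d 1, ∀ w ∈ layer d 1, dotCLM m ζ (G.leftDiff x (G.ad u w)) = 0 := by
    intro u hu w hw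
    have hl : ∀ k, d k = 1 → dotCLM m ζ (G.leftDiff x (G.ad (stdVec k) w)) = 0 := by
      intro k hk
      have hle : layer d 1 ≤
          ((dotCLM m ζ).comp ((G.leftDiff x).comp (G.ad (stdVec k)))).ker := by
        rw [layer, Submodule.span_le]
        rintro _ ⟨l, hl, rfl⟩
        exact hpair k l hk hl
      exact hle hw
    have hle : layer d 1 ≤
        ((dotCLM m ζ).comp ((G.leftDiff x).comp (G.ad.flip w))).ker := by
      rw [layer, Submodule.span_le]
      rintro _ ⟨k, hk, rfl⟩
      exact hl k hk
    exact hle hu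
  have hle : layer d 2 ≤ ((dotCLM m ζ).comp (G.leftDiff x)).ker := by
    rw [hd.layer_succ 1 le_rfl, Submodule.span_le]
    rintro _ ⟨u, hu, w, hw, rfl⟩
    have h := hbil u hu w hw
    rw [ad_apply] at h
    exact h
  have h : dotCLM m ζ (G.leftDiff x z) = 0 := hle hz
  rwa [dotCLM_apply] at h

/-- A covector that does not vanish on the third layer detects one of the brackets
`[X_j, X_i]` when the second layer is spanned by `X_i`. -/
theorem IsStratified.dual_bracket_ne_zero {d : Fin m → ℕ} {s : ℕ} (hd : G.IsStratified d s)
    {i : Fin m} (hi : layer d 2 = Submodule.span ℝ {stdVec i}) {j₀ j₁ : HorIdx d}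
    (hj : ∀ j, j = j₀ ∨ j = j₁) (L : (Fin m → ℝ) →L[ℝ] ℝ) {k : Fin m} (hk : d k = 3)
    (hL : L (stdVec k) ≠ 0) :
    L (G.bracket (stdVec j₀.1) (stdVec i)) ^ 2 + L (G.bracket (stdVec j₁.1) (stdVec i)) ^ 2
      ≠ 0 := by
  intro h0
  have h1 : L (G.ad (stdVec j₀.1) (stdVec i)) = 0 := by rw [ad_apply]; nlinarith
  have h2 : L (G.ad (stdVec j₁.1) (stdVec i)) = 0 := by rw [ad_apply]; nlinarith
  have hle1 : layer d 1 ≤ (L.comp (G.ad.flip (stdVec i))).ker := by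
    rw [layer, Submodule.span_le]
    rintro _ ⟨l, hl, rfl⟩
    rcases hj ⟨l, hl⟩ with h | h
    · have : l = j₀.1 := congrArg Subtype.val h
      rw [this]; exact h1
    · have : l = j₁.1 := congrArg Subtype.val h
      rw [this]; exact h2
  have hle : layer d 3 ≤ L.ker := by
    rw [hd.layer_succ 2 one_le_two, Submodule.span_le]
    rintro _ ⟨u, hu, w, hw, rfl⟩
    rw [hi] at hw
    obtain ⟨a, rfl⟩ := Submodule.mem_span_singleton.1 hw
    have h3 : L (G.ad u (stdVec i)) = 0 := hle1 hu
    change L (G.bracket u (a • stdVec i)) = 0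
    rw [← ad_apply, map_smul, map_smul, h3, smul_zero]
  apply hL
  have := stdVec_mem_layer d k
  rw [hk] at this
  exact hle this

theorem smul_hor_add_smul_hor_eq_zero {d : Fin m → ℕ} {j₀ j₁ : HorIdx d} (hne : j₀ ≠ j₁)
    (x : Fin m → ℝ)
    (a b : ℝ) (h : a • G.hor d j₀ x + b • G.hor d j₁ x = 0) : a = 0 ∧ b = 0 := by
  have h1 : G.leftDiff x (a • stdVec j₀.1 + b • stdVec j₁.1) = G.leftDiff x 0 := by
    rw [map_add, map_smul, map_smul, map_zero]; exact h
  have h2 := G.leftDiff_injective x h1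
  have hne' : j₀.1 ≠ j₁.1 := fun h => hne (Subtype.ext h)
  constructor
  · simpa [stdVec, hne'] using congrFun h2 j₀.1
  · simpa [stdVec, hne'.symm] using congrFun h2 j₁.1

/-- The rotated unit gradient field `(-f₁ X₀ + f₀ X₁) / |f|`. -/
def rotatedField (G : LieGroupLaw m) {d : Fin m → ℕ} (j₀ j₁ : HorIdx d) (f₀ f₁ : (Fin m → ℝ) → ℝ)
    (x : Fin m → ℝ) : Fin m → ℝ :=
  (-f₁ x / √(f₀ x ^ 2 + f₁ x ^ 2)) • G.hor d j₀ x + (f₀ x / √(f₀ x ^ 2 + f₁ x ^ 2)) • G.hor d j₁ x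

theorem IsSecondType.analyticAt_rotatedField (hG : G.IsSecondType) {d : Fin m → ℕ}
    (j₀ j₁ : HorIdx d) {f₀ f₁ : (Fin m → ℝ) → ℝ} {x : Fin m → ℝ} (h₀ : AnalyticAt ℝ f₀ x)
    (h₁ : AnalyticAt ℝ f₁ x) (hx : f₀ x ^ 2 + f₁ x ^ 2 ≠ 0) :
    AnalyticAt ℝ (G.rotatedField j₀ j₁ f₀ f₁) x := by
  have hpos : 0 < f₀ x ^ 2 + f₁ x ^ 2 := lt_of_le_of_ne (by positivity) hx.symm
  have hs : AnalyticAt ℝ (fun y => √(f₀ y ^ 2 + f₁ y ^ 2)) x :=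
    ((((h₀.pow 2).add (h₁.pow 2)).contDiffAt (n := ω)).sqrt hx).analyticAt
  have hs0 : √(f₀ x ^ 2 + f₁ x ^ 2) ≠ 0 := (Real.sqrt_pos.2 hpos).ne'
  exact ((h₁.neg.div hs hs0).smul (hG.analyticAt_leftDiff_apply (stdVec j₀.1) x)).add
    ((h₀.div hs hs0).smul (hG.analyticAt_leftDiff_apply (stdVec j₁.1) x))

/-- A planar vector orthogonal to `(a, b)` is a multiple of the unit vector `(-b, a)/|(a, b)|`; the
factor `κ` is the inner product with it. -/
theorem rotated_coordinates {a b h₀ h₁ : ℝ} (hab : a ^ 2 + b ^ 2 ≠ 0) (h : h₀ * a + h₁ * b = 0) :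
    let κ := (-h₀ * b + h₁ * a) / √(a ^ 2 + b ^ 2)
    κ * (-b / √(a ^ 2 + b ^ 2)) = h₀ ∧ κ * (a / √(a ^ 2 + b ^ 2)) = h₁ ∧
      κ ^ 2 = h₀ ^ 2 + h₁ ^ 2 := by
  intro κ
  have hpos : 0 < a ^ 2 + b ^ 2 := lt_of_le_of_ne (by positivity) hab.symm
  have hs : √(a ^ 2 + b ^ 2) * √(a ^ 2 + b ^ 2) = a ^ 2 + b ^ 2 := Real.mul_self_sqrt hpos.le
  have h1 : κ * (-b / √(a ^ 2 + b ^ 2)) = h₀ := by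
    rw [div_mul_div_comm, hs, div_eq_iff hab]
    linear_combination (-a) * h
  have h2 : κ * (a / √(a ^ 2 + b ^ 2)) = h₁ := by
    rw [div_mul_div_comm, hs, div_eq_iff hab]
    linear_combination (-b) * h
  refine ⟨h1, h2, ?_⟩
  rw [div_pow, sq √(a ^ 2 + b ^ 2), hs, div_eq_iff hab]
  linear_combination (-(h₀ * a + h₁ * b)) * h

theorem rotated_sq {a b : ℝ} (hab : a ^ 2 + b ^ 2 ≠ 0) :
    (-b / √(a ^ 2 + b ^ 2)) ^ 2 + (a / √(a ^ 2 + b ^ 2)) ^ 2 = 1 := by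
  rw [div_pow, div_pow, Real.sq_sqrt (by positivity), ← add_div, div_eq_one_iff_eq hab]
  ring

/-- A horizontal curve of a rank two distribution on which an analytic function vanishes whose
horizontal gradient does not vanish along the curve is a reparametrization of an analytic
horizontal curve of unit speed. -/
theorem IsSecondType.exists_unit_speed (hG : G.IsSecondType) {d : Fin m → ℕ} {j₀ j₁ : HorIdx d}
    (hne : j₀ ≠ j₁) (hj : ∀ j, j = j₀ ∨ j = j₁) {γ : ℝ → Fin m → ℝ} {h : ℝ → HorIdx d → ℝ}
    (hγ : IsHorizontalCurve (G.hor d) γ h) {P : (Fin m → ℝ) → ℝ} (hP : ∀ x, AnalyticAt ℝ P x)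
    {f : HorIdx d → (Fin m → ℝ) → ℝ} (hf : ∀ j x, AnalyticAt ℝ (f j) x)
    (hPf : ∀ j x, fderiv ℝ P x (G.hor d j x) = f j x)
    (hP0 : ∀ t ∈ Set.Icc (0 : ℝ) 1, P (γ t) = 0)
    (hf0 : ∀ t ∈ Set.Icc (0 : ℝ) 1, f j₀ (γ t) ^ 2 + f j₁ (γ t) ^ 2 ≠ 0) :
    ∃ (a b : ℝ) (c : ℝ → Fin m → ℝ) (τ κ : ℝ → ℝ),
      AnalyticOnNhd ℝ c (Set.Ioo a b) ∧
      (∀ σ ∈ Set.Ioo a b, ∃ u : HorIdx d → ℝ, ∑ j, u j ^ 2 = 1 ∧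
        HasDerivAt c (∑ j, u j • G.hor d j (c σ)) σ) ∧
      (∃ K, LipschitzOnWith K τ (Set.Icc 0 1)) ∧
      Set.MapsTo τ (Set.Icc 0 1) (Set.Ioo a b) ∧
      (∀ t ∈ Set.Icc (0 : ℝ) 1, γ t = c (τ t)) ∧
      ∀ᵐ t ∂volume.restrict (Set.Icc (0 : ℝ) 1),
        HasDerivAt τ (κ t) t ∧ κ t ^ 2 = ∑ j, h t j ^ 2 := by
  set V : Set (Fin m → ℝ) := {x | f j₀ x ^ 2 + f j₁ x ^ 2 ≠ 0} with hV
  have hfc : ∀ j, Continuous (f j) := fun j =>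
    continuous_iff_continuousAt.2 fun x => (hf j x).continuousAt
  have hγc : ContinuousOn γ (Set.Icc 0 1) := hγ.lipschitz.choose_spec.continuousOn
  have hVo : IsOpen V :=
    isOpen_ne_fun (((hfc j₀).pow 2).add ((hfc j₁).pow 2)) continuous_const
  set κ : ℝ → ℝ := fun t => (-h t j₀ * f j₁ (γ t) + h t j₁ * f j₀ (γ t)) /
    √(f j₀ (γ t) ^ 2 + f j₁ (γ t) ^ 2) with hκ
  have hperp : ∀ᵐ t ∂volume.restrict (Set.Icc (0 : ℝ) 1),
      h t j₀ * f j₀ (γ t) + h t j₁ * f j₁ (γ t) = 0 := by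
    filter_upwards [hγ.hasDerivAt, ae_restrict_mem measurableSet_Icc] with t h1 ht
    have h2 := (hP (γ t)).differentiableAt.hasFDerivAt.comp_hasDerivAt t h1
    rw [sum_eq_add_of_pair hne hj, map_add, map_smul, map_smul, hPf, hPf] at h2
    -- `P ∘ γ` vanishes only on `[0,1]`, so derivatives are compared within the interval.
    have h3 : HasDerivWithinAt (P ∘ γ) 0 (Set.Icc 0 1) t :=
      (hasDerivWithinAt_const t (Set.Icc (0 : ℝ) 1) (0 : ℝ)).congr (fun r hr => hP0 r hr)
        (hP0 t ht)
    exact UniqueDiffWithinAt.eq_deriv _ (uniqueDiffOn_Icc zero_lt_one t ht)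
      h2.hasDerivWithinAt h3
  have hκe : ∀ᵐ t ∂volume.restrict (Set.Icc (0 : ℝ) 1),
      κ t * (-f j₁ (γ t) / √(f j₀ (γ t) ^ 2 + f j₁ (γ t) ^ 2)) = h t j₀ ∧
      κ t * (f j₀ (γ t) / √(f j₀ (γ t) ^ 2 + f j₁ (γ t) ^ 2)) = h t j₁ ∧
      κ t ^ 2 = h t j₀ ^ 2 + h t j₁ ^ 2 := by
    filter_upwards [hperp, ae_restrict_mem measurableSet_Icc] with t h1 ht
    exact rotated_coordinates (hf0 t ht) h1
  have hfm : ∀ j, AEStronglyMeasurable (fun t => f j (γ t)) (volume.restrict (Set.Icc 0 1)) :=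
    fun j => ((hfc j).comp_continuousOn hγc).aestronglyMeasurable measurableSet_Icc
  have hsm : AEStronglyMeasurable (fun t => √(f j₀ (γ t) ^ 2 + f j₁ (γ t) ^ 2))
      (volume.restrict (Set.Icc 0 1)) :=
    ContinuousOn.aestronglyMeasurable
      (Real.continuous_sqrt.comp_continuousOn ((((hfc j₀).comp_continuousOn hγc).pow 2).add
        (((hfc j₁).comp_continuousOn hγc).pow 2))) measurableSet_Icc
  have hhm : ∀ j, AEStronglyMeasurable (fun t => h t j) (volume.restrict (Set.Icc 0 1)) :=
    fun j => (continuous_apply j).comp_aestronglyMeasurable hγ.memLp.aestronglyMeasurable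
  have hκm : AEStronglyMeasurable κ (volume.restrict (Set.Icc 0 1)) :=
    ((((hhm j₀).neg.mul (hfm j₁)).add ((hhm j₁).mul (hfm j₀))).aemeasurable.div
      hsm.aemeasurable).aestronglyMeasurable
  have hκB : ∀ᵐ t ∂volume.restrict (Set.Icc (0 : ℝ) 1),
      |κ t| ≤ 2 * lpNorm h ⊤ (volume.restrict (Set.Icc (0 : ℝ) 1)) := by
    filter_upwards [hκe, ae_le_lpNorm_exponent_top hγ.memLp] with t h1 h2
    have hn := norm_nonneg (h t)
    have h3 : |h t j₀| ≤ ‖h t‖ := norm_le_pi_norm (h t) j₀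
    have h4 : |h t j₁| ≤ ‖h t‖ := norm_le_pi_norm (h t) j₁
    -- `|κ|` is the Euclidean length of `h`, while the norm here is the sup norm; the factor `2`
    -- generously covers `√2`.
    have h5 : |κ t| ≤ 2 * ‖h t‖ := by
      refine abs_le_of_sq_le_sq ?_ (by positivity)
      rw [h1.2.2]
      have h6 := sq_le_sq' (by linarith [abs_nonneg (h t j₀)]) h3
      have h7 := sq_le_sq' (by linarith [abs_nonneg (h t j₁)]) h4
      rw [sq_abs] at h6 h7
      nlinarith
    linarith
  have hγ' : ∀ᵐ t ∂volume.restrict (Set.Icc (0 : ℝ) 1),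
      HasDerivAt γ (κ t • G.rotatedField j₀ j₁ (f j₀) (f j₁) (γ t)) t := by
    filter_upwards [hγ.hasDerivAt, hκe] with t h1 h2
    refine h1.congr_deriv ?_
    rw [sum_eq_add_of_pair hne hj, rotatedField, smul_add, smul_smul, smul_smul, h2.1, h2.2.1]
  obtain ⟨a, b, c, τ, hca, hcd, hτL, hτm, heq, hτ'⟩ := exists_analytic_reparametrization hVo
    (fun x hx => hG.analyticAt_rotatedField j₀ j₁ (hf j₀ x) (hf j₁ x) hx) hγ.lipschitz hf0
    hκm hκB hγ'
  refine ⟨a, b, c, τ, κ, hca, fun σ hσ => ?_, hτL, hτm, heq, ?_⟩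
  · classical
    obtain ⟨hcV, hcσ⟩ := hcd σ hσ
    refine ⟨fun j => if j = j₀ then -f j₁ (c σ) / √(f j₀ (c σ) ^ 2 + f j₁ (c σ) ^ 2)
      else f j₀ (c σ) / √(f j₀ (c σ) ^ 2 + f j₁ (c σ) ^ 2), ?_, ?_⟩
    · rw [sum_eq_add_of_pair hne hj]
      beta_reduce
      rw [if_pos rfl, if_neg hne.symm]
      exact rotated_sq hcV
    · rw [sum_eq_add_of_pair hne hj]
      beta_reduce
      rw [if_pos rfl, if_neg hne.symm]
      exact hcσ
  · filter_upwards [hτ', hκe] with t h1 h2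
    exact ⟨h1, by rw [h2.2.2, sum_eq_add_of_pair hne hj]⟩

end LieGroupLaw

end Carnot

end

/-! ### Goh extremals of rank two -/

theorem mainTheorem8 {m : ℕ} (G : Carnot.LieGroupLaw m) (hG : G.IsSecondType)
    (d : Fin m → ℕ) (s : ℕ) (hd : G.IsStratified d s)
    (hrank : Module.finrank ℝ (Carnot.layer d 1) = 2) (hs : 3 ≤ s)
    (γ : ℝ → Fin m → ℝ) (h : ℝ → Carnot.HorIdx d → ℝ) (ξ : ℝ → Fin m → ℝ)
    (hγ : Carnot.IsGohExtremalWith (G.hor d) γ h ξ)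
    (hξ : ∀ t ∈ Set.Icc (0 : ℝ) 1, ∃ k, d k = 3 ∧ G.dualComponent γ ξ k t ≠ 0) :
    -- the curve lies on the hypersurface `P_3^v = 0`, which is regular along the curve and
    -- transversal there to the horizontal distribution
    (∃ v : Fin m → ℝ, v ≠ 0 ∧ ∃ i : Fin m, (i : ℕ) = 2 ∧
      ∀ t ∈ Set.Icc (0 : ℝ) 1,
        G.extremalPoly s i v (γ t) = 0 ∧
        fderiv ℝ (G.extremalPoly s i v) (γ t) ≠ 0 ∧
        Module.finrank ℝ
          ↥((fderiv ℝ (G.extremalPoly s i v) (γ t)).ker ⊓ G.distribution d (γ t)) = 1) ∧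
    -- the curve is, up to the choice of the parameter, an analytic unit speed horizontal curve
    (∃ (a b : ℝ) (c : ℝ → Fin m → ℝ) (τ : ℝ → ℝ),
      AnalyticOnNhd ℝ c (Set.Ioo a b) ∧
      (∀ σ ∈ Set.Ioo a b, ∃ u : Carnot.HorIdx d → ℝ, ∑ j, u j ^ 2 = 1 ∧
        HasDerivAt c (∑ j, u j • G.hor d j (c σ)) σ) ∧
      (∃ K, LipschitzOnWith K τ (Set.Icc 0 1)) ∧
      Set.MapsTo τ (Set.Icc 0 1) (Set.Ioo a b) ∧
      ∀ t ∈ Set.Icc (0 : ℝ) 1, γ t = c (τ t)) ∧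
    -- if the parameter is proportional to arc length and the curve does not turn back on itself,
    -- then the curve is analytic in that parameter
    (∀ ρ : ℝ,
      (∀ᵐ t ∂MeasureTheory.volume.restrict (Set.Icc (0 : ℝ) 1), ∑ j, h t j ^ 2 = ρ) →
      (∀ t ∈ Set.Icc (0 : ℝ) 1, ∃ U ∈ nhds t, Set.InjOn γ (U ∩ Set.Icc 0 1)) →
      AnalyticOn ℝ γ (Set.Icc 0 1)) := by
  obtain ⟨j₀, j₁, hne, hj, i, hi, hi2⟩ := hd.rank_two hrank hs
  obtain ⟨v, hv⟩ := G.exists_dual_eq_coadjoint hγ.horizontal hγ.lipschitz hγ.adjoint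
  have hP : G.extremalPoly s i v = fun x => v ⬝ᵥ G.Ad x (Carnot.stdVec i) :=
    funext fun x => hd.extremalPoly_eq hG i v x
  have hPf : ∀ (j : Carnot.HorIdx d) x, fderiv ℝ (G.extremalPoly s i v) x (G.hor d j x) =
      v ⬝ᵥ G.Ad x (G.bracket (Carnot.stdVec j.1) (Carnot.stdVec i)) := by
    intro j x
    rw [hP]
    exact G.fderiv_dotProduct_Ad_leftDiff v _ _ x
  have hP0 : ∀ t ∈ Set.Icc (0 : ℝ) 1, G.extremalPoly s i v (γ t) = 0 := by
    intro t ht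
    rw [hP]
    simp only
    rw [← hv t ht]
    refine hd.dual_layer_two_eq_zero (hγ.goh t ht) ?_
    rw [hi2]
    exact Submodule.mem_span_singleton_self _
  have hf0 : ∀ t ∈ Set.Icc (0 : ℝ) 1,
      (v ⬝ᵥ G.Ad (γ t) (G.bracket (Carnot.stdVec j₀.1) (Carnot.stdVec i))) ^ 2 +
        (v ⬝ᵥ G.Ad (γ t) (G.bracket (Carnot.stdVec j₁.1) (Carnot.stdVec i))) ^ 2 ≠ 0 := by
    intro t ht
    obtain ⟨k, hk, hne0⟩ := hξ t ht
    -- Nonvanishing is read off from the moving covector `ξ t`, then transported to the constant `v`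
    -- by `hv`.
    have h1 := hd.dual_bracket_ne_zero hi2 hj ((Carnot.dotCLM m (ξ t)).comp (G.leftDiff (γ t))) hk
      (by rw [ContinuousLinearMap.comp_apply, Carnot.dotCLM_apply]; exact hne0)
    simpa only [ContinuousLinearMap.comp_apply, Carnot.dotCLM_apply, hv t ht] using h1
  have hv0 : v ≠ 0 := by
    rintro rfl
    apply hf0 0 ⟨le_rfl, zero_le_one⟩
    simp
  have hf0' : ∀ t ∈ Set.Icc (0 : ℝ) 1,
      fderiv ℝ (G.extremalPoly s i v) (γ t) (G.hor d j₀ (γ t)) ^ 2 +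
        fderiv ℝ (G.extremalPoly s i v) (γ t) (G.hor d j₁ (γ t)) ^ 2 ≠ 0 := by
    intro t ht
    rw [hPf, hPf]
    exact hf0 t ht
  obtain ⟨a, b, c, τ, κ, hca, hcd, hτL, hτm, heq, hτ'⟩ := hG.exists_unit_speed hne hj
    hγ.horizontal (P := G.extremalPoly s i v)
    (fun x => by rw [hP]; exact hG.analyticAt_dotProduct_Ad v _ x)
    (f := fun j x => v ⬝ᵥ G.Ad x (G.bracket (Carnot.stdVec j.1) (Carnot.stdVec i)))
    (fun j x => hG.analyticAt_dotProduct_Ad v _ x) hPf hP0 hf0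
  refine ⟨⟨v, hv0, i, hi, fun t ht => ⟨hP0 t ht, ?_, ?_⟩⟩,
    ⟨a, b, c, τ, hca, hcd, hτL, hτm, heq⟩, ?_⟩
  · intro hz
    apply hf0' t ht
    rw [hz]
    simp
  · exact Carnot.finrank_ker_inf_span_pair _ (fun j => G.hor d j (γ t)) j₀ j₁ hj
      (Carnot.LieGroupLaw.smul_hor_add_smul_hor_eq_zero hne (γ t)) (hf0' t ht)
  · intro ρ hρ hinj t₀ ht₀
    -- Since `γ = c ∘ τ`, injectivity of `γ` passes to the inner function `τ`.
    have hτinj : ∃ U ∈ nhds t₀, Set.InjOn τ (U ∩ Set.Icc 0 1) := by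
      obtain ⟨U, hU, hUi⟩ := hinj t₀ ht₀
      refine ⟨U, hU, fun x hx y hy hxy => hUi hx hy ?_⟩
      rw [heq x hx.2, heq y hy.2, hxy]
    obtain ⟨A, B, hAB⟩ := Carnot.eventually_affine_of_injOn (κ := κ) (ρ := ρ) hτL (by
      filter_upwards [hτ', hρ] with t h1 h2
      exact ⟨h1.1, by rw [h1.2, h2]⟩) ht₀ hτinj
    have h0 : τ t₀ = A * t₀ + B := hAB.self_of_nhdsWithin ht₀
    have hlin : AnalyticAt ℝ (fun t : ℝ => A * t + B) t₀ :=
      (analyticAt_const.mul analyticAt_id).add analyticAt_const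
    have hc : AnalyticAt ℝ (fun t : ℝ => c (A * t + B)) t₀ :=
      AnalyticAt.comp_of_eq (hca (τ t₀) (hτm ht₀)) hlin h0.symm
    refine hc.analyticWithinAt.congr_of_eventuallyEq ?_ (by rw [heq t₀ ht₀, h0])
    filter_upwards [hAB, self_mem_nhdsWithin] with t h1 ht
    rw [heq t ht, h1]
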